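/- Let $\mathbb N=\{1,2,3,\dots\}$ and $\mathbb T=[0,1]$, and for a bounded measurable $w>0$ on $(0,1)$ let $L^2(\mathbb T,w)$ be the space of measurable $f:(0,1)\to\mathbb C$ with $\int_0^1|f(t)|^2\,w(t)\,dt<\infty$ (modulo equality almost everywhere). Let $\Gamma\subset\mathbb N$ satisfy $\sum_{\gamma\in\Gamma}\frac1{\sqrt\gamma}<\infty$. Then, for every $w$ that is positive, increasing (not necessarily strictly) and bounded on $(0,1)$ and satisfies $\int_0^1\log w(t)\,dt=-\infty$, the exponentials $\{e^{2\pi i n t}: n\in\mathbb N\setminus\Gamma\}$ span $L^2(\mathbb T,w)$, that is, their finite linear combinations are dense in $L^2(\mathbb T,w)$. In particular, for every such $w$ the exponentials $\{e^{2\pi i n t}: n\in\mathbb N\setminus\{k^3:k\in\mathbb N\}\}$ span $L^2(\mathbb T,w)$. -/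

import Mathlib

open MeasureTheory Set
open scoped ENNReal

noncomputable section

/-- The integral of `log w` over `(0,1)` equals `-∞`: the positive part of `log w` has a finite
integral, and the negative part has an infinite one. -/
def LogIntegralEqNegInfty (w : ℝ → ℝ) : Prop :=
  (∫⁻ t in Ioo (0 : ℝ) 1, ENNReal.ofReal (Real.log (w t))) < ∞ ∧
    (∫⁻ t in Ioo (0 : ℝ) 1, ENNReal.ofReal (-Real.log (w t))) = ∞

/-- The weights with a deep right-hand zero at the origin: `w` is positive, increasing (in the wide
sense) and bounded on `(0,1)`, and the integral of `log w` over `(0,1)` is `-∞`. Values of `w`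
outside `(0,1)` play no role. -/
structure IsDeepZeroWeight (w : ℝ → ℝ) : Prop where
  pos : ∀ t ∈ Ioo (0 : ℝ) 1, 0 < w t
  mono : MonotoneOn w (Ioo (0 : ℝ) 1)
  bdd : ∃ M : ℝ, ∀ t ∈ Ioo (0 : ℝ) 1, w t ≤ M
  log_int : LogIntegralEqNegInfty w

/-- The measure `w(t) dt` on the circle, the circle being `[0,1]` with its Lebesgue measure
(the end points are a null set), so that `L²(𝕋, w)` is `Lp ℂ 2 (weightMeasure w)`. -/
def weightMeasure (w : ℝ → ℝ) : Measure ℝ :=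
  (volume.restrict (Ioo (0 : ℝ) 1)).withDensity (fun t => ENNReal.ofReal (w t))

/-- The exponential `t ↦ e^{2πint}`. -/
def expo (n : ℕ) (t : ℝ) : ℂ := Complex.exp (2 * Real.pi * Complex.I * n * t)

/-- The family of exponentials with frequencies in `S`, as a set of elements of `L²(𝕋, w)`. -/
def expSystem (w : ℝ → ℝ) (S : Set ℕ) : Set (Lp ℂ 2 (weightMeasure w)) :=
  {f | ∃ n ∈ S, f =ᵐ[weightMeasure w] expo n}

/-- The exponentials with frequencies in `S` span `L²(𝕋, w)`: the closed linear span of the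
family is the whole space. -/
def ExpSystemSpans (w : ℝ → ℝ) (S : Set ℕ) : Prop :=
  (Submodule.span ℂ (expSystem w S)).topologicalClosure = ⊤

/-- For the weights considered, every exponential does belong to `L²(𝕋, w)`, so that no frequency
is lost in `expSystem`. -/
theorem IsDeepZeroWeight.memLp_expo {w : ℝ → ℝ} (hw : IsDeepZeroWeight w) (n : ℕ) :
    MemLp (expo n) 2 (weightMeasure w) := by
  obtain ⟨M, hM⟩ := hw.bdd
  have hfin : IsFiniteMeasure (weightMeasure w) := by
    refine isFiniteMeasure_withDensity (ne_of_lt ?_)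
    calc (∫⁻ t in Ioo (0 : ℝ) 1, ENNReal.ofReal (w t))
        ≤ ∫⁻ _ in Ioo (0 : ℝ) 1, ENNReal.ofReal M :=
          setLIntegral_mono measurable_const
            (fun t ht => ENNReal.ofReal_le_ofReal (hM t ht))
      _ < ∞ := by simp
  have hc : Continuous (expo n) := by unfold expo; fun_prop
  refine MemLp.of_bound hc.aestronglyMeasurable 1 (Filter.Eventually.of_forall fun t => ?_)
  have h : (2 * Real.pi * Complex.I * n * t : ℂ) = ((2 * Real.pi * n * t : ℝ) : ℂ) * Complex.I := by
    push_cast; ring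
  rw [expo, h, Complex.norm_exp_ofReal_mul_I]

end

open Real (posLog)
open scoped ComplexConjugate

/-! Let f be orthogonal to the system and put g = w · conj f, so that the moments ∫ g e^{2πint}
vanish for every n ≥ 1 outside Γ. The aim is ∫ g = 0 (`integral_eq_zero_of_deep_zero`). Multiplying
g by e^{-2πint} shifts Γ and gives the other moments of index ≤ 0 one by one. A second pass over
conj g, with no exceptional frequencies left, gives the remaining ones, hence g = 0.

To kill the exceptional moments, take P(x) = ∏ (1 + x/γ) over a finite S ⊂ Γ. The rational function
K equal to ∑ P(n) ζⁿ inside the disc expands outside as -∑ P(-n) ζ⁻ⁿ, n ≥ 1. Hence F(z) = ∫ g(t) K(z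
e^{-2πit}) dt satisfies F(0) = ∫ g, while outside the disc only the frequencies in Γ \ S survive,
and F is as small there as desired once S is a long truncation of Γ.

The price is the pole of K at 1, of order growing with S. Since P has nonnegative coefficients in
the binomial basis, any bound P(x) ≤ e^{B + yx} on x ≥ 0 makes K harmless at distance at least 6y
from 1 (`norm_multKernel_le`). At the scale ρ = |1 - z| one takes y of order ∑ min(ρ², 1/γ) and B of
order ∑ log⁺(1/(γρ²)). The condition ∑ 1/√γ < ∞ enters twice: it lets an analytic self-map of the
disc push z to depth 6y while moving it by little compared with ρ (`pushMap`), and it makes B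
integrable in ρ. A finite part T of Γ is treated apart, so that the remaining sum is tiny.

Thus log |F ∘ pushMap| has an integrable majorant on circles, uniformly in S. Near e^{2πit} with t
small, g is small on (0, 2t), and the transform of the rest of g continues across the circle, where
it is small outside; a two-constants argument then gains log η(2t), with η = w^{1/8}. Jensen's
inequality at 0 bounds log |∫ g| by a constant plus ∫ log η(2t) dt over (τ, 1/4), which tends to -∞
as τ tends to 0 along suitable values. -/

/-! ### The binomial basis and the multiplier kernel -/

/-- The polynomial `x ↦ (x + 1) ⋯ (x + k) / k!`, that is, the binomial coefficient `x + k` over `k`. -/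
noncomputable def risingBinom (k : ℕ) (x : ℂ) : ℂ := ∏ j ∈ Finset.range k, (x + (j + 1)) / (j + 1)

theorem risingBinom_zero_right (k : ℕ) : risingBinom k 0 = 1 := by
  unfold risingBinom
  refine Finset.prod_eq_one fun j _ => ?_
  rw [zero_add]
  exact div_self (Nat.cast_add_one_ne_zero j)

theorem risingBinom_succ (k : ℕ) (x : ℂ) :
    risingBinom (k + 1) x = risingBinom k x * ((x + (k + 1)) / (k + 1)) := by
  rw [risingBinom, risingBinom, Finset.prod_range_succ]

theorem risingBinom_neg_of_lt {k n : ℕ} (h : n < k) : risingBinom k (-((n : ℂ) + 1)) = 0 := by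
  unfold risingBinom
  refine Finset.prod_eq_zero (Finset.mem_range.2 h) ?_
  simp

theorem risingBinom_neg_add (k m : ℕ) :
    risingBinom k (-(((m + k : ℕ) : ℂ) + 1)) = (-1) ^ k * ((m + k).choose k : ℂ) := by
  induction k generalizing m with
  | zero => simp [risingBinom]
  | succ k ih =>
    have h := ih (m + 1)
    rw [show m + 1 + k = m + (k + 1) by ring] at h
    rw [risingBinom_succ, h]
    have hc := Nat.choose_succ_right_eq (m + (k + 1)) k
    have hc' : ((m + (k + 1)).choose (k + 1) : ℂ) * (k + 1) =
        ((m + (k + 1)).choose k : ℂ) * (m + 1) := by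
      have : m + (k + 1) - k = m + 1 := by omega
      rw [this] at hc
      exact_mod_cast hc
    have hk : (k + 1 : ℂ) ≠ 0 := Nat.cast_add_one_ne_zero k
    rw [← mul_div_assoc, div_eq_iff hk, pow_succ, mul_assoc ((-1 : ℂ) ^ k * -1), hc']
    push_cast
    ring

/-- Expansion at infinity of a power of `1 / (1 - ζ)`. -/
theorem hasSum_risingBinom_neg (k : ℕ) {ζ : ℂ} (hζ : 1 < ‖ζ‖) :
    HasSum (fun n : ℕ => risingBinom k (-((n : ℂ) + 1)) * (ζ⁻¹) ^ (n + 1))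
      (-(1 / (1 - ζ) ^ (k + 1))) := by
  have h0 : ζ ≠ 0 := by
    rintro rfl
    simp at hζ
    linarith
  have hu : ‖ζ⁻¹‖ < 1 := by
    rw [norm_inv]
    exact inv_lt_one_of_one_lt₀ hζ
  have h1 := (hasSum_choose_mul_geometric_of_norm_lt_one k hu).mul_left ((-1) ^ k * (ζ⁻¹) ^ (k + 1))
  -- The terms with n < k vanish, since -1, …, -k are the zeros of `risingBinom k`. What remains is
  -- a shifted binomial series in 1/ζ.
  rw [← hasSum_nat_add_iff' k]
  have hz : ∑ i ∈ Finset.range k, risingBinom k (-((i : ℂ) + 1)) * (ζ⁻¹) ^ (i + 1) = 0 :=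
    Finset.sum_eq_zero fun i hi => by
      rw [risingBinom_neg_of_lt (Finset.mem_range.1 hi), zero_mul]
  rw [hz, sub_zero]
  have h2 : 1 - ζ ≠ 0 := by
    intro h
    rw [← sub_eq_zero.1 h] at hζ
    simp at hζ
  have h3 : ζ - 1 ≠ 0 := by
    intro h
    exact h2 (by linear_combination -h)
  have h4 : (-1) ^ k * (ζ⁻¹) ^ (k + 1) * (1 / (1 - ζ⁻¹) ^ (k + 1)) = -(1 / (1 - ζ) ^ (k + 1)) := by
    have e1 : (1 - ζ⁻¹) = (ζ - 1) * ζ⁻¹ := by field_simp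
    have e2 : (1 - ζ) ^ (k + 1) = -((-1) ^ k * (ζ - 1) ^ (k + 1)) := by
      rw [show 1 - ζ = (-1) * (ζ - 1) by ring, mul_pow, pow_succ (-1 : ℂ) k]
      ring
    have e3 : ((-1 : ℂ) ^ k) * (-1) ^ k = 1 := by
      rw [← mul_pow]
      simp
    have e4 : ((-1 : ℂ) ^ k) ≠ 0 := pow_ne_zero _ (by norm_num)
    rw [e1, e2, mul_pow]
    have e5 : (ζ - 1) ^ (k + 1) ≠ 0 := pow_ne_zero _ h3
    have e6 : (ζ⁻¹) ^ (k + 1) ≠ 0 := pow_ne_zero _ (inv_ne_zero h0)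
    field_simp
    linear_combination e3
  rw [h4] at h1
  have hf : (fun n : ℕ => risingBinom k (-(((n + k : ℕ) : ℂ) + 1)) * (ζ⁻¹) ^ (n + k + 1)) =
      fun n : ℕ => (-1) ^ k * ζ⁻¹ ^ (k + 1) * (((n + k).choose k : ℂ) * ζ⁻¹ ^ n) := by
    funext n
    rw [risingBinom_neg_add]
    ring
  rw [hf]
  exact h1

/-- The product `∏ (1 + x / γ)` over distinct positive integers has nonnegative coefficients in
the basis `risingBinom`. -/
theorem exists_coeff_risingBinom (S : Finset ℕ) (hS : ∀ γ ∈ S, 1 ≤ γ) :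
    ∃ b : ℕ → ℝ, (∀ k, 0 ≤ b k) ∧ (∀ k, S.card < k → b k = 0) ∧
      ∀ x : ℂ, ∏ γ ∈ S, (1 + x / γ) = ∑ k ∈ Finset.range (S.card + 1), (b k : ℂ) * risingBinom k x := by
  induction S using Finset.induction_on_max with
  | empty =>
    refine ⟨fun k => if k = 0 then 1 else 0, fun k => by positivity, fun k hk => ?_, fun x => ?_⟩
    · rw [Finset.card_empty] at hk
      simp [hk.ne']
    · simp [risingBinom]
  | insert a s ha ih =>
    obtain ⟨b, hb0, hbc, hb⟩ := ih fun γ hγ => hS γ (Finset.mem_insert_of_mem hγ)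
    have has : a ∉ s := fun h => lt_irrefl _ (ha a h)
    -- Here distinctness and integrality are used: inserting the elements in increasing order gives
    -- `k + 1 ≤ a` for all k up to the degree reached so far, which keeps the factor `1 - (k + 1) /
    -- a` nonnegative.
    have hcard : s.card + 1 ≤ a := by
      have hsub : s ⊆ Finset.Ico 1 a := fun x hx =>
        Finset.mem_Ico.2 ⟨hS x (Finset.mem_insert_of_mem hx), ha x hx⟩
      have h1 := Finset.card_le_card hsub
      rw [Nat.card_Ico] at h1
      have h2 := hS a (Finset.mem_insert_self _ _)
      omega
    have ha0 : (0 : ℝ) < a := by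
      have h2 := hS a (Finset.mem_insert_self _ _)
      exact_mod_cast h2
    have ha0' : (a : ℂ) ≠ 0 := by exact_mod_cast ha0.ne'
    -- This is the recursion (1 + x/a) R_k = ((k+1)/a) R_{k+1} + (1 - (k+1)/a) R_k for R_k =
    -- `risingBinom k`. At k = 0 the truncated index `k - 1` is harmless, because its factor
    -- vanishes.
    refine ⟨fun k => (k : ℝ) / a * b (k - 1) + (1 - (k + 1) / a) * b k, fun k => ?_, fun k hk => ?_,
      fun x => ?_⟩
    · rcases le_or_gt k s.card with hk | hk
      · have : ((k : ℝ) + 1) / a ≤ 1 := by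
          rw [div_le_one ha0]
          exact_mod_cast (by omega : k + 1 ≤ a)
        have h1 := mul_nonneg (sub_nonneg.2 this) (hb0 k)
        have h2 := mul_nonneg (div_nonneg (Nat.cast_nonneg k) ha0.le) (hb0 (k - 1))
        exact add_nonneg h2 h1
      · beta_reduce
        rw [hbc k hk, mul_zero, add_zero]
        exact mul_nonneg (div_nonneg (Nat.cast_nonneg k) ha0.le) (hb0 (k - 1))
    · rw [Finset.card_insert_of_notMem has] at hk
      beta_reduce
      rw [hbc k (by omega), hbc (k - 1) (by omega)]
      simp
    · rw [Finset.prod_insert has, hb x, Finset.card_insert_of_notMem has, Finset.mul_sum]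
      have hterm : ∀ k : ℕ, (1 + x / a) * ((b k : ℂ) * risingBinom k x) =
          ((k + 1 : ℕ) : ℂ) / a * b k * risingBinom (k + 1) x +
            (1 - ((k : ℂ) + 1) / a) * b k * risingBinom k x := by
        intro k
        have hk : (k + 1 : ℂ) ≠ 0 := Nat.cast_add_one_ne_zero k
        rw [risingBinom_succ]
        push_cast
        field_simp
        ring
      simp only [hterm]
      rw [Finset.sum_add_distrib]
      have h1 : ∑ k ∈ Finset.range (s.card + 1 + 1),
          (((k : ℝ) / a * b (k - 1) + (1 - (k + 1) / a) * b k : ℝ) : ℂ) * risingBinom k x =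
          (∑ k ∈ Finset.range (s.card + 1 + 1), (k : ℂ) / a * b (k - 1) * risingBinom k x) +
          ∑ k ∈ Finset.range (s.card + 1 + 1), (1 - ((k : ℂ) + 1) / a) * b k * risingBinom k x := by
        rw [← Finset.sum_add_distrib]
        refine Finset.sum_congr rfl fun k _ => ?_
        push_cast
        ring
      rw [h1, Finset.sum_range_succ' _ (s.card + 1),
        Finset.sum_range_succ (fun k : ℕ => (1 - ((k : ℂ) + 1) / a) * b k * risingBinom k x)
          (s.card + 1), hbc (s.card + 1) (by omega)]
      simp

/-- The analytic continuation of `∑ₙ P(n) ζⁿ`, for `P = ∑ b k * risingBinom k` of degree at most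
`m`. -/
noncomputable def multKernel (b : ℕ → ℝ) (m : ℕ) (ζ : ℂ) : ℂ :=
  ∑ k ∈ Finset.range (m + 1), (b k : ℂ) * (1 / (1 - ζ) ^ (k + 1))

/-- A zero of P at -γ therefore removes the frequency γ from the expansion outside the disc; this is
the purpose of the kernel. -/
theorem hasSum_multKernel {b : ℕ → ℝ} {m : ℕ} {P : ℂ → ℂ}
    (hP : ∀ x, P x = ∑ k ∈ Finset.range (m + 1), (b k : ℂ) * risingBinom k x) {ζ : ℂ}
    (hζ : 1 < ‖ζ‖) :
    HasSum (fun n : ℕ => P (-((n : ℂ) + 1)) * (ζ⁻¹) ^ (n + 1)) (-multKernel b m ζ) := by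
  have h := hasSum_sum (s := Finset.range (m + 1)) fun k _ =>
    (hasSum_risingBinom_neg k hζ).mul_left (b k : ℂ)
  have h1 : (fun n : ℕ => P (-((n : ℂ) + 1)) * (ζ⁻¹) ^ (n + 1)) = fun n : ℕ =>
      ∑ k ∈ Finset.range (m + 1), (b k : ℂ) * (risingBinom k (-((n : ℂ) + 1)) * ζ⁻¹ ^ (n + 1)) := by
    funext n
    rw [hP, Finset.sum_mul]
    exact Finset.sum_congr rfl fun k _ => by ring
  have h2 : -multKernel b m ζ =
      ∑ k ∈ Finset.range (m + 1), (b k : ℂ) * -(1 / (1 - ζ) ^ (k + 1)) := by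
    simp only [multKernel, mul_neg, Finset.sum_neg_distrib]
  rw [h1, h2]
  exact h

/-- A nonnegative combination of `risingBinom` of exponential type `y` has a kernel that is small
at distance more than `6 y` from `1`. -/
theorem norm_multKernel_le {b : ℕ → ℝ} {m : ℕ} (hb : ∀ k, 0 ≤ b k) {B y : ℝ} (hy : 0 < y)
    (hP : ∀ x : ℝ, 0 ≤ x →
      ‖∑ k ∈ Finset.range (m + 1), (b k : ℂ) * risingBinom k (x : ℂ)‖ ≤ Real.exp (B + y * x))
    {ζ : ℂ} (hζ : 6 * y ≤ ‖1 - ζ‖) :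
    ‖multKernel b m ζ‖ ≤ 2 * Real.exp B / ‖1 - ζ‖ := by
  have hd : 0 < ‖1 - ζ‖ := by linarith
  have key : ∀ k ∈ Finset.range (m + 1), b k ≤ Real.exp B * (3 * y) ^ k := by
    intro k hk
    have hR : ∀ (j : ℕ) (x : ℝ), risingBinom j (x : ℂ) =
        ((∏ i ∈ Finset.range j, (x + (i + 1)) / (i + 1) : ℝ) : ℂ) := by
      intro j x
      simp [risingBinom]
    have hRnn : ∀ (j : ℕ) (x : ℝ), 0 ≤ x → 0 ≤ ∏ i ∈ Finset.range j, (x + (i + 1)) / ((i : ℝ) + 1) :=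
      fun j x hx => Finset.prod_nonneg fun i _ => by positivity
    have h1 : ∀ x : ℝ, 0 ≤ x →
        b k * ∏ i ∈ Finset.range k, (x + (i + 1)) / ((i : ℝ) + 1) ≤ Real.exp (B + y * x) := by
      intro x hx
      have h2 := hP x hx
      simp only [hR] at h2
      have h3 : (∑ k ∈ Finset.range (m + 1), (b k : ℂ) *
          ((∏ i ∈ Finset.range k, (x + (i + 1)) / (i + 1) : ℝ) : ℂ)) =
          ((∑ k ∈ Finset.range (m + 1), b k * ∏ i ∈ Finset.range k, (x + (i + 1)) / (i + 1) : ℝ) : ℂ)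
          := by push_cast; rfl
      rw [h3, Complex.norm_real, Real.norm_eq_abs] at h2
      refine le_trans ?_ ((le_abs_self _).trans h2)
      exact Finset.single_le_sum (f := fun k => b k * ∏ i ∈ Finset.range k, (x + (i + 1)) / ((i : ℝ) + 1))
        (fun j _ => mul_nonneg (hb j) (hRnn j x hx)) hk
    -- The choice x = k/y minimises e^{yx}/x^k. Each factor of the k-th basis polynomial is then at
    -- least 1/y, so `b k` ≤ e^B (e y)^k, and e ≤ 3. When 6y ≤ |1 - ζ| the kernel is thus dominated
    -- by a geometric series of ratio 1/2.
    have h4 := h1 (k / y) (by positivity)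
    have h5 : (1 / y) ^ k ≤ ∏ i ∈ Finset.range k, ((k : ℝ) / y + (i + 1)) / ((i : ℝ) + 1) := by
      rw [← Finset.card_range k, ← Finset.prod_const, Finset.card_range]
      refine Finset.prod_le_prod (fun i _ => by positivity) fun i hi => ?_
      have hik : ((i : ℝ) + 1) ≤ k := by exact_mod_cast Finset.mem_range.1 hi
      rw [div_le_div_iff₀ hy (by positivity)]
      have : (k : ℝ) / y * y = k := div_mul_cancel₀ _ hy.ne'
      nlinarith [mul_pos hy (by positivity : (0 : ℝ) < (i : ℝ) + 1)]
    have h6 : b k * (1 / y) ^ k ≤ Real.exp (B + y * (k / y)) :=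
      (mul_le_mul_of_nonneg_left h5 (hb k)).trans h4
    rw [mul_div_cancel₀ _ hy.ne', Real.exp_add] at h6
    have h7 : Real.exp (k : ℝ) ≤ 3 ^ k := by
      rw [← Real.exp_one_pow]
      exact pow_le_pow_left₀ (Real.exp_pos 1).le (by linarith [Real.exp_one_lt_d9]) k
    have hyk : 0 < y ^ k := pow_pos hy k
    rw [div_pow, one_pow, mul_one_div, div_le_iff₀ hyk] at h6
    calc b k ≤ Real.exp B * Real.exp k * y ^ k := h6
      _ ≤ Real.exp B * 3 ^ k * y ^ k := by gcongr
      _ = _ := by rw [mul_pow]; ring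
  have h8 : ∀ k ∈ Finset.range (m + 1), ‖(b k : ℂ) * (1 / (1 - ζ) ^ (k + 1))‖ ≤
      Real.exp B / ‖1 - ζ‖ * (1 / 2) ^ k := by
    intro k hk
    rw [norm_mul, norm_div, norm_one, norm_pow, Complex.norm_real, Real.norm_of_nonneg (hb k)]
    have h9 : (3 * y) ^ k ≤ (1 / 2) ^ k * ‖1 - ζ‖ ^ k := by
      rw [← mul_pow]
      exact pow_le_pow_left₀ (by positivity) (by linarith) k
    calc b k * (1 / ‖1 - ζ‖ ^ (k + 1))
        ≤ (Real.exp B * ((1 / 2) ^ k * ‖1 - ζ‖ ^ k)) * (1 / ‖1 - ζ‖ ^ (k + 1)) := by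
          gcongr
          exact (key k hk).trans (by gcongr)
      _ = _ := by
          rw [pow_succ ‖1 - ζ‖ k]
          field_simp
  calc ‖multKernel b m ζ‖ ≤ ∑ k ∈ Finset.range (m + 1), Real.exp B / ‖1 - ζ‖ * (1 / 2) ^ k :=
        norm_sum_le_of_le _ h8
    _ = Real.exp B / ‖1 - ζ‖ * ∑ k ∈ Finset.range (m + 1), (1 / 2) ^ k := by rw [Finset.mul_sum]
    _ ≤ Real.exp B / ‖1 - ζ‖ * 2 := by
        gcongr
        exact sum_geometric_two_le _
    _ = _ := by ring

/-! ### The transform of a function on the circle -/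

/-- The point `e^{2πit}` of the unit circle. -/
noncomputable def circlePt (t : ℝ) : ℂ := Complex.exp (2 * Real.pi * t * Complex.I)

theorem norm_circlePt (t : ℝ) : ‖circlePt t‖ = 1 := by
  rw [circlePt, show (2 * Real.pi * t * Complex.I : ℂ) = ((2 * Real.pi * t : ℝ) : ℂ) * Complex.I by
    push_cast; ring, Complex.norm_exp_ofReal_mul_I]

theorem circlePt_ne_zero (t : ℝ) : circlePt t ≠ 0 := Complex.exp_ne_zero _

theorem continuous_circlePt : Continuous circlePt := by
  unfold circlePt
  fun_prop

theorem norm_one_sub_div_circlePt (z : ℂ) (t : ℝ) : ‖1 - z / circlePt t‖ = ‖circlePt t - z‖ := by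
  have h : 1 - z / circlePt t = (circlePt t - z) / circlePt t := by
    rw [sub_div, div_self (circlePt_ne_zero t)]
  rw [h, norm_div, norm_circlePt, div_one]

/-- The integral of `g` against the kernel `multKernel b m` over the set `A`. -/
noncomputable def multTransform (b : ℕ → ℝ) (m : ℕ) (g : ℝ → ℂ) (A : Set ℝ) (z : ℂ) : ℂ :=
  ∫ t in A, g t * multKernel b m (z / circlePt t)

theorem measurable_multKernel (b : ℕ → ℝ) (m : ℕ) : Measurable (multKernel b m) := by
  unfold multKernel
  fun_prop

theorem norm_multKernel_le_of_le (b : ℕ → ℝ) (m : ℕ) {δ : ℝ} (hδ : 0 < δ) {ζ : ℂ}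
    (h : δ ≤ ‖1 - ζ‖) :
    ‖multKernel b m ζ‖ ≤ ∑ k ∈ Finset.range (m + 1), |b k| * (1 / δ ^ (k + 1)) := by
  refine norm_sum_le_of_le _ fun k _ => ?_
  rw [norm_mul, norm_div, norm_one, norm_pow, Complex.norm_real, Real.norm_eq_abs]
  gcongr

section
variable {b : ℕ → ℝ} {m : ℕ} {g : ℝ → ℂ} {A : Set ℝ} {z : ℂ}

theorem aestronglyMeasurable_multKernel_comp (b : ℕ → ℝ) (m : ℕ) (z : ℂ) (μ : Measure ℝ) :
    AEStronglyMeasurable (fun t => multKernel b m (z / circlePt t)) μ := by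
  refine Measurable.aestronglyMeasurable ?_
  exact (measurable_multKernel b m).comp (measurable_const.div continuous_circlePt.measurable)

theorem integrableOn_mul_multKernel (b : ℕ → ℝ) (m : ℕ) (hA : MeasurableSet A)
    (hg : IntegrableOn g A) {δ : ℝ} (hδ : 0 < δ) (h : ∀ t ∈ A, δ ≤ ‖circlePt t - z‖) :
    IntegrableOn (fun t => g t * multKernel b m (z / circlePt t)) A := by
  refine Integrable.mul_bdd (c := ∑ k ∈ Finset.range (m + 1), |b k| * (1 / δ ^ (k + 1))) hg
    (aestronglyMeasurable_multKernel_comp _ _ _ _) ?_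
  filter_upwards [ae_restrict_mem hA] with t ht
  refine norm_multKernel_le_of_le b m hδ ?_
  rw [norm_one_sub_div_circlePt]
  exact h t ht

theorem norm_multTransform_le (hb : ∀ k, 0 ≤ b k) {B y d : ℝ} (hy : 0 < y)
    (hP : ∀ x : ℝ, 0 ≤ x →
      ‖∑ k ∈ Finset.range (m + 1), (b k : ℂ) * risingBinom k (x : ℂ)‖ ≤ Real.exp (B + y * x))
    (hA : MeasurableSet A) (hg : IntegrableOn g A) (hd : 6 * y ≤ d)
    (h : ∀ t ∈ A, d ≤ ‖circlePt t - z‖) :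
    ‖multTransform b m g A z‖ ≤ 2 * Real.exp B / d * ∫ t in A, ‖g t‖ := by
  rw [← integral_const_mul]
  refine norm_integral_le_of_norm_le (hg.norm.const_mul _) ?_
  filter_upwards [ae_restrict_mem hA] with t ht
  have hd0 : 0 < d := by linarith
  rw [norm_mul, mul_comm]
  gcongr
  have h1 := h t ht
  rw [← norm_one_sub_div_circlePt] at h1
  refine (norm_multKernel_le hb hy hP (hd.trans h1)).trans ?_
  gcongr

theorem multTransform_union {A' : Set ℝ} (hA : MeasurableSet A) (hA' : MeasurableSet A')
    (hdis : Disjoint A A') (hg : IntegrableOn g (A ∪ A')) {δ : ℝ} (hδ : 0 < δ)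
    (h : ∀ t ∈ A ∪ A', δ ≤ ‖circlePt t - z‖) :
    multTransform b m g (A ∪ A') z = multTransform b m g A z + multTransform b m g A' z := by
  unfold multTransform
  exact setIntegral_union hdis hA'
    (integrableOn_mul_multKernel b m hA (hg.mono_set subset_union_left) hδ
      fun t ht => h t (Or.inl ht))
    (integrableOn_mul_multKernel b m hA' (hg.mono_set subset_union_right) hδ
      fun t ht => h t (Or.inr ht))

theorem hasDerivAt_multKernel {ζ : ℂ} (h : 1 - ζ ≠ 0) :
    HasDerivAt (multKernel b m)
      (∑ k ∈ Finset.range (m + 1), (b k : ℂ) * ((k + 1) / (1 - ζ) ^ (k + 2))) ζ := by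
  unfold multKernel
  refine HasDerivAt.fun_sum fun k _ => HasDerivAt.const_mul _ ?_
  have h1 : HasDerivAt (fun ζ : ℂ => 1 - ζ) (-1) ζ := by
    simpa using (hasDerivAt_id ζ).const_sub 1
  have h2 := (h1.fun_pow (k + 1)).fun_inv (pow_ne_zero (k + 1) h)
  simp only [one_div]
  convert h2 using 1
  push_cast
  rw [← pow_mul, show (k + 1) * 2 = (k + 2) + k by ring, pow_add _ (k + 2) k]
  have h3 : (1 - ζ) ^ k ≠ 0 := pow_ne_zero _ h
  have h4 : (1 - ζ) ^ (k + 2) ≠ 0 := pow_ne_zero _ h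
  field_simp

theorem differentiableAt_multTransform (b : ℕ → ℝ) (m : ℕ) (hA : MeasurableSet A)
    (hg : IntegrableOn g A) {δ : ℝ} (hδ : 0 < δ)
    (h : ∀ v ∈ Metric.ball z δ, ∀ t ∈ A, δ ≤ ‖circlePt t - v‖) :
    DifferentiableAt ℂ (multTransform b m g A) z := by
  set K' : ℂ → ℂ := fun ζ => ∑ k ∈ Finset.range (m + 1), (b k : ℂ) * ((k + 1) / (1 - ζ) ^ (k + 2))
    with hK'
  have hK'm : Measurable K' := by
    rw [hK']
    fun_prop
  have hmeas : AEStronglyMeasurable (fun t => K' (z / circlePt t) * (circlePt t)⁻¹)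
      (volume.restrict A) := by
    refine Measurable.aestronglyMeasurable ?_
    exact (hK'm.comp (measurable_const.div continuous_circlePt.measurable)).mul
      continuous_circlePt.measurable.inv
  have hz : z ∈ Metric.ball z δ := Metric.mem_ball_self hδ
  refine (hasDerivAt_integral_of_dominated_loc_of_deriv_le (μ := volume.restrict A)
    (F := fun v t => g t * multKernel b m (v / circlePt t))
    (F' := fun v t => g t * (K' (v / circlePt t) * (circlePt t)⁻¹))
    (bound := fun t => ‖g t‖ * ∑ k ∈ Finset.range (m + 1), |b k| * ((k + 1) / δ ^ (k + 2)))
    (Metric.ball_mem_nhds z hδ) ?_ ?_ ?_ ?_ ?_ ?_).2.differentiableAt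
  · exact Filter.Eventually.of_forall fun v =>
      hg.aestronglyMeasurable.mul (aestronglyMeasurable_multKernel_comp _ _ _ _)
  · exact integrableOn_mul_multKernel b m hA hg hδ (h z hz)
  · exact hg.aestronglyMeasurable.mul hmeas
  · filter_upwards [ae_restrict_mem hA] with t ht v hv
    rw [norm_mul, norm_mul, norm_inv, norm_circlePt, inv_one, mul_one]
    gcongr
    refine norm_sum_le_of_le _ fun k _ => ?_
    rw [norm_mul, norm_div, norm_pow, Complex.norm_real, Real.norm_eq_abs,
      norm_one_sub_div_circlePt]
    have h1 : ‖(k + 1 : ℂ)‖ = k + 1 := by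
      exact_mod_cast Complex.norm_natCast (k + 1)
    rw [h1]
    have := h v hv t ht
    gcongr
  · exact hg.norm.mul_const _
  · filter_upwards [ae_restrict_mem hA] with t ht v hv
    have h1 : 1 - v / circlePt t ≠ 0 := by
      rw [← norm_pos_iff, norm_one_sub_div_circlePt]
      exact hδ.trans_le (h v hv t ht)
    have h2 : HasDerivAt (fun v : ℂ => v / circlePt t) (circlePt t)⁻¹ v := by
      simpa using (hasDerivAt_id v).div_const (circlePt t)
    exact ((hasDerivAt_multKernel h1).comp v h2).const_mul (g t)

theorem multTransform_zero_right
    (hP : ∑ k ∈ Finset.range (m + 1), (b k : ℂ) * risingBinom k 0 = 1) :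
    multTransform b m g A 0 = ∫ t in A, g t := by
  have h1 : multKernel b m 0 = 1 := by
    rw [← hP]
    simp [multKernel, risingBinom_zero_right]
  simp [multTransform, h1]

/-- Outside the unit disc the transform is small if the multiplier vanishes at every frequency
`-n`, `1 ≤ n ≤ N`, that `g` has. -/
theorem norm_multTransform_le_of_one_lt {P : ℂ → ℂ}
    (hP : ∀ x, P x = ∑ k ∈ Finset.range (m + 1), (b k : ℂ) * risingBinom k x)
    (hg : IntegrableOn g A) {C q ϑ : ℝ} (hC : 0 ≤ C) (hq : 0 ≤ q)
    (hϑ : ϑ < 1) (hz : 1 < ‖z‖) (hqz : q ≤ ϑ * ‖z‖)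
    (hPq : ∀ n : ℕ, ‖P (-((n : ℂ) + 1))‖ ≤ C * q ^ (n + 1)) {N : ℕ}
    (hN : ∀ n < N, P (-((n : ℂ) + 1)) = 0 ∨ ∫ t in A, g t * circlePt t ^ (n + 1) = 0) :
    ‖multTransform b m g A z‖ ≤ C * (∫ t in A, ‖g t‖) * ϑ ^ N / (1 - ϑ) := by
  have hz0 : 0 < ‖z‖ := by linarith
  have hϑ0 : 0 ≤ ϑ := by
    by_contra hneg
    push Not at hneg
    nlinarith
  have hcoef : ∀ n : ℕ, ‖P (-((n : ℂ) + 1))‖ * (‖z‖⁻¹) ^ (n + 1) ≤ C * ϑ ^ (n + 1) := by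
    intro n
    have h1 : q * ‖z‖⁻¹ ≤ ϑ := by
      rw [← div_eq_mul_inv, div_le_iff₀ hz0]
      exact hqz
    calc ‖P (-((n : ℂ) + 1))‖ * (‖z‖⁻¹) ^ (n + 1) ≤ C * q ^ (n + 1) * (‖z‖⁻¹) ^ (n + 1) := by
          gcongr
          exact hPq n
      _ = C * (q * ‖z‖⁻¹) ^ (n + 1) := by rw [mul_pow]; ring
      _ ≤ _ := by gcongr
  set f : ℕ → ℝ → ℂ := fun n t => g t * (P (-((n : ℂ) + 1)) * ((z / circlePt t)⁻¹) ^ (n + 1)) with hf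
  have hfn : ∀ n t, ‖f n t‖ ≤ C * ϑ ^ (n + 1) * ‖g t‖ := by
    intro n t
    rw [hf]
    simp only [norm_mul, norm_pow, norm_inv, norm_div, norm_circlePt, div_one]
    rw [mul_comm]
    exact mul_le_mul_of_nonneg_right (hcoef n) (norm_nonneg _)
  have hgeo : Summable fun n : ℕ => C * ϑ ^ (n + 1) := by
    have := (summable_geometric_of_lt_one hϑ0 hϑ).mul_left (C * ϑ)
    exact this.congr fun n => by ring
  have hfeq : ∀ n, ∫ t in A, f n t =
      P (-((n : ℂ) + 1)) * (z⁻¹) ^ (n + 1) * ∫ t in A, g t * circlePt t ^ (n + 1) := by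
    intro n
    rw [← integral_const_mul]
    congr 1
    funext t
    rw [hf]
    simp only [inv_div, div_pow, inv_pow]
    ring
  have hsum : HasSum (fun n => ∫ t in A, f n t) (∫ t in A, g t * -multKernel b m (z / circlePt t)) := by
    refine hasSum_integral_of_dominated_convergence (fun n t => C * ϑ ^ (n + 1) * ‖g t‖) ?_ ?_ ?_ ?_ ?_
    · intro n
      refine hg.aestronglyMeasurable.mul (Measurable.aestronglyMeasurable ?_)
      have := continuous_circlePt.measurable
      fun_prop
    · exact fun n => Filter.Eventually.of_forall (hfn n)
    · exact Filter.Eventually.of_forall fun t => hgeo.mul_right _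
    · simp_rw [tsum_mul_right]
      exact hg.norm.const_mul _
    · refine Filter.Eventually.of_forall fun t => ?_
      refine (hasSum_multKernel hP ?_).mul_left (g t)
      rw [norm_div, norm_circlePt, div_one]
      exact hz
  have hneg : ∫ t in A, g t * -multKernel b m (z / circlePt t) = -multTransform b m g A z := by
    simp only [mul_neg, integral_neg, multTransform]
  have hz' : ∀ n < N, ∫ t in A, f n t = 0 := by
    intro n hn
    rw [hfeq]
    rcases hN n hn with h | h <;> rw [h] <;> ring
  have hsum' := (hasSum_nat_add_iff' N).2 hsum
  rw [Finset.sum_eq_zero (fun i hi => hz' i (Finset.mem_range.1 hi)), sub_zero, hneg] at hsum'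
  have hbd : HasSum (fun n : ℕ => C * (∫ t in A, ‖g t‖) * ϑ ^ (N + 1) * ϑ ^ n)
      (C * (∫ t in A, ‖g t‖) * ϑ ^ (N + 1) * (1 - ϑ)⁻¹) :=
    (hasSum_geometric_of_lt_one hϑ0 hϑ).mul_left _
  have hle := hsum'.norm_le_of_bounded hbd (fun n => ?_)
  · rw [norm_neg] at hle
    refine hle.trans ?_
    rw [← div_eq_mul_inv]
    have h0 : 0 ≤ ∫ t in A, ‖g t‖ := integral_nonneg fun t => norm_nonneg _
    have : 0 < 1 - ϑ := by linarith
    have h2 : ϑ ^ (N + 1) ≤ ϑ ^ N := pow_le_pow_of_le_one hϑ0 hϑ.le (Nat.le_succ N)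
    gcongr
  · refine (norm_integral_le_of_norm_le (hg.norm.const_mul (C * ϑ ^ (n + N + 1)))
      (Filter.Eventually.of_forall (hfn (n + N)))).trans (le_of_eq ?_)
    rw [integral_const_mul]
    ring
end

/-! ### Jensen's inequality and a two-constants estimate -/

theorem circleMap_zero_two_pi_mul (r t : ℝ) : circleMap 0 r (2 * Real.pi * t) = r * circlePt t := by
  simp [circleMap, circlePt]

/-- Jensen's inequality on a circle, with an upper bound for `log ‖f‖` that need only hold off the
zeros of `f`. -/
theorem log_norm_le_integral_of_le {f : ℂ → ℂ} {r : ℝ} (hr : 0 < r) (hr1 : r < 1)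
    (hf : DifferentiableOn ℂ f (Metric.ball 0 1)) (hf0 : f 0 ≠ 0) {V : ℝ → ℝ}
    (hV : IntervalIntegrable V volume 0 1)
    (hfV : ∀ t ∈ Ioo (0 : ℝ) 1, f (r * circlePt t) ≠ 0 → Real.log ‖f (r * circlePt t)‖ ≤ V t) :
    Real.log ‖f 0‖ ≤ ∫ t in (0 : ℝ)..1, V t := by
  have han : AnalyticOnNhd ℂ f (Metric.closedBall 0 |r|) := by
    have h1 : AnalyticOnNhd ℂ f (Metric.ball 0 1) := hf.analyticOnNhd Metric.isOpen_ball
    refine h1.mono (Metric.closedBall_subset_ball ?_)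
    rwa [abs_of_pos hr]
  have hJ := han.circleAverage_log_norm hr.ne' hf0
  have hpos : 0 ≤ ∑ᶠ u, MeromorphicOn.divisor f (Metric.closedBall 0 |r|) u *
      Real.log (r * ‖(0 : ℂ) - u‖⁻¹) := by
    refine finsum_nonneg fun u => ?_
    by_cases hu : u ∈ Metric.closedBall (0 : ℂ) |r|
    · have h1 : 0 ≤ MeromorphicOn.divisor f (Metric.closedBall 0 |r|) u :=
        MeromorphicOn.AnalyticOnNhd.divisor_nonneg han u
      rcases eq_or_ne u 0 with rfl | hu0
      · simp
      · have h2 : 0 < ‖u‖ := norm_pos_iff.2 hu0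
        rw [mem_closedBall_zero_iff, abs_of_pos hr] at hu
        refine mul_nonneg (by exact_mod_cast h1) (Real.log_nonneg ?_)
        rw [zero_sub, norm_neg, ← div_eq_mul_inv, le_div_iff₀ h2, one_mul]
        exact hu
    · rw [Function.locallyFinsuppWithin.apply_eq_zero_of_notMem _ hu]
      simp
  have hle : Real.log ‖f 0‖ ≤ Real.circleAverage (fun z => Real.log ‖f z‖) 0 r := by
    rw [hJ]
    linarith
  have hpi : (0 : ℝ) < 2 * Real.pi := Real.two_pi_pos
  have hsub : Real.circleAverage (fun z => Real.log ‖f z‖) 0 r =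
      ∫ t in (0 : ℝ)..1, Real.log ‖f (r * circlePt t)‖ := by
    have h1 := intervalIntegral.integral_comp_mul_left (a := 0) (b := 1)
      (fun θ => Real.log ‖f (circleMap 0 r θ)‖) hpi.ne'
    simp only [circleMap_zero_two_pi_mul, mul_zero, mul_one] at h1
    rw [h1, Real.circleAverage_def]
  have hint : IntervalIntegrable (fun t => Real.log ‖f (r * circlePt t)‖) volume 0 1 := by
    have h1 : CircleIntegrable (fun z => Real.log ‖f z‖) 0 r :=
      (han.mono Metric.sphere_subset_closedBall).meromorphicOn.circleIntegrable_log_norm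
    have h2 := IntervalIntegrable.comp_mul_left h1 (c := 2 * Real.pi)
    simp only [circleMap_zero_two_pi_mul, zero_div, div_self hpi.ne'] at h2
    exact h2
  -- At a zero of f the convention `Real.log 0 = 0` could violate the bound by V; the zeros on the
  -- circle form a null set.
  have hne : ∀ᵐ t : ℝ, f (r * circlePt t) ≠ 0 := by
    have h1 := han.preimage_zero_mem_codiscreteWithin hf0 (by simp)
      ((convex_closedBall (0 : ℂ) |r|).isConnected (Metric.nonempty_closedBall.2 (abs_nonneg r)))
    have h2 := circleMap_preimage_codiscrete hr.ne' (Filter.codiscreteWithin_mono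
      Metric.sphere_subset_closedBall h1)
    have h3 := ae_restrict_le_codiscreteWithin (μ := (volume : Measure ℝ)) MeasurableSet.univ h2
    rw [Measure.restrict_univ] at h3
    have h4 : ∀ᵐ θ : ℝ, f (circleMap 0 r θ) ≠ 0 := h3
    have h5 := (Measure.quasiMeasurePreserving_smul (volume : Measure ℝ) hpi.ne').ae h4
    filter_upwards [h5] with t ht
    rwa [smul_eq_mul, circleMap_zero_two_pi_mul] at ht
  rw [hsub] at hle
  refine hle.trans ?_
  rw [intervalIntegral.integral_of_le zero_le_one, intervalIntegral.integral_of_le zero_le_one,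
    integral_Ioc_eq_integral_Ioo, integral_Ioc_eq_integral_Ioo]
  rw [intervalIntegrable_iff_integrableOn_Ioo_of_le zero_le_one] at hV hint
  refine setIntegral_mono_ae_restrict hint hV ?_
  filter_upwards [ae_restrict_mem measurableSet_Ioo, ae_restrict_of_ae hne] with t ht ht'
  exact hfV t ht ht'

/-- One of the four quarter-turns of u makes an angle of at most π/4 with w, and cos(π/4) > 7/10. -/
theorem exists_norm_add_I_pow_mul_ge (w u : ℂ) :
    ∃ k < 4, ‖w‖ + 7 / 10 * ‖u‖ ≤ ‖w + Complex.I ^ k * u‖ := by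
  have hsq : ∀ v : ℂ, ‖v‖ = ‖u‖ → 7 / 10 * (‖w‖ * ‖u‖) ≤ w.re * v.re + w.im * v.im →
      ‖w‖ + 7 / 10 * ‖u‖ ≤ ‖w + v‖ := by
    intro v hv h
    have h1 : ‖w + v‖ ^ 2 = ‖w‖ ^ 2 + ‖v‖ ^ 2 + 2 * (w.re * v.re + w.im * v.im) := by
      simp only [← Complex.normSq_eq_norm_sq, Complex.normSq_apply, Complex.add_re, Complex.add_im]
      ring
    refine (sq_le_sq₀ (by positivity) (norm_nonneg _)).1 ?_
    rw [h1, hv]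
    nlinarith [sq_nonneg ‖u‖]
  set a := w.re * u.re + w.im * u.im with ha
  set b := w.im * u.re - w.re * u.im with hb
  have hab : (‖w‖ * ‖u‖) ^ 2 = a ^ 2 + b ^ 2 := by
    rw [mul_pow]
    simp only [← Complex.normSq_eq_norm_sq, Complex.normSq_apply]
    rw [ha, hb]
    ring
  have hp : 0 ≤ ‖w‖ * ‖u‖ := by positivity
  have hcases : 7 / 10 * (‖w‖ * ‖u‖) ≤ a ∨ 7 / 10 * (‖w‖ * ‖u‖) ≤ b ∨
      7 / 10 * (‖w‖ * ‖u‖) ≤ -a ∨ 7 / 10 * (‖w‖ * ‖u‖) ≤ -b := by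
    by_contra! hcon
    obtain ⟨h1, h2, h3, h4⟩ := hcon
    have h5 : a ^ 2 ≤ (7 / 10 * (‖w‖ * ‖u‖)) ^ 2 := sq_le_sq' (by linarith) h1.le
    have h6 : b ^ 2 ≤ (7 / 10 * (‖w‖ * ‖u‖)) ^ 2 := sq_le_sq' (by linarith) h2.le
    have h7 : 0 < ‖w‖ * ‖u‖ := by linarith
    nlinarith
  rcases hcases with h | h | h | h
  · exact ⟨0, by norm_num, hsq _ (by simp) (by simp; linarith)⟩
  · exact ⟨1, by norm_num, hsq _ (by simp) (by simp; linarith)⟩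
  · exact ⟨2, by norm_num, hsq _ (by simp) (by simp; linarith)⟩
  · exact ⟨3, by norm_num, hsq _ (by simp) (by simp [Complex.I_pow_three]; linarith)⟩

/-- A form of the two-constants theorem: an analytic function that is small on the part of a circle
turned away from the origin is small at the centre. -/
theorem norm_pow_four_le {f : ℂ → ℂ} {w : ℂ} {R M ε : ℝ} (hR : 0 < R)
    (hf : ∀ v ∈ Metric.closedBall w R, DifferentiableAt ℂ f v)
    (hM : ∀ v ∈ Metric.closedBall w R, ‖f v‖ ≤ M)
    (hε : ∀ v ∈ Metric.closedBall w R, ‖w‖ + 7 / 10 * R ≤ ‖v‖ → ‖f v‖ ≤ ε) :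
    ‖f w‖ ^ 4 ≤ M ^ 3 * ε := by
  have hmem : ∀ k : ℕ, ∀ u ∈ Metric.closedBall (0 : ℂ) R,
      w + Complex.I ^ k * u ∈ Metric.closedBall w R := by
    intro k u hu
    rw [mem_closedBall_zero_iff] at hu
    rw [Metric.mem_closedBall, dist_eq_norm, add_sub_cancel_left, norm_mul, norm_pow,
      Complex.norm_I, one_pow, one_mul]
    exact hu
  have hM0 : 0 ≤ M := (norm_nonneg _).trans (hM w (Metric.mem_closedBall_self hR.le))
  -- At each boundary point one of the four rotated factors lies in the region where f is at most ε,
  -- so the maximum principle for the product gives `M ^ 3 * ε` at the centre.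
  set G : ℂ → ℂ := fun u => ∏ k ∈ Finset.range 4, f (w + Complex.I ^ k * u) with hG
  have hGd : DifferentiableOn ℂ G (Metric.closedBall 0 R) := by
    intro u hu
    refine DifferentiableAt.differentiableWithinAt ?_
    refine DifferentiableAt.fun_finsetProd fun k _ => ?_
    exact (hf _ (hmem k u hu)).comp (f := fun u => w + Complex.I ^ k * u) u (by fun_prop)
  have hGc : DiffContOnCl ℂ G (Metric.ball 0 R) := by
    refine DifferentiableOn.diffContOnCl ?_
    rwa [closure_ball _ hR.ne']
  have hbd : ∀ u ∈ frontier (Metric.ball (0 : ℂ) R), ‖G u‖ ≤ M ^ 3 * ε := by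
    intro u hu
    rw [frontier_ball _ hR.ne', mem_sphere_zero_iff_norm] at hu
    have huc : u ∈ Metric.closedBall (0 : ℂ) R := by
      rw [mem_closedBall_zero_iff, hu]
    obtain ⟨k, hk, hkn⟩ := exists_norm_add_I_pow_mul_ge w u
    rw [hu] at hkn
    rw [hG]
    simp only
    rw [norm_prod, ← Finset.mul_prod_erase _ _ (Finset.mem_range.2 hk), mul_comm]
    refine mul_le_mul ?_ (hε _ (hmem k u huc) hkn) (norm_nonneg _) (by positivity)
    have hcard : ((Finset.range 4).erase k).card = 3 := by
      rw [Finset.card_erase_of_mem (Finset.mem_range.2 hk), Finset.card_range]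
    rw [← hcard]
    exact (Finset.prod_le_prod (fun _ _ => norm_nonneg _) fun j _ => hM _ (hmem j u huc)).trans
      (by rw [Finset.prod_const])
  have h := Complex.norm_le_of_forall_mem_frontier_norm_le Metric.isBounded_ball hGc hbd
    (z := 0) (subset_closure (Metric.mem_ball_self hR))
  simpa [hG] using h

/-! ### Growth of the product at each scale, and the inward map -/

/-- An exponential type for the product `∏ (1 + x / γ)` at the scale `ρ`. -/
noncomputable def scaleType (S : Finset ℕ) (ε ρ : ℝ) : ℝ :=
  ∑ γ ∈ S, min (ρ ^ 2) (1 / (γ : ℝ)) + ε * ρ ^ 2 / 24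

/-- The logarithm of the constant that goes with `scaleType`, for a product with `m` more factors. -/
noncomputable def scaleLog (S : Finset ℕ) (m : ℕ) (ε ρ : ℝ) : ℝ :=
  ∑ γ ∈ S, posLog (1 / (γ * ρ ^ 2)) + m * Real.log (24 * (m + 1) / (ε * ρ ^ 2))

/-- A function with real part at least `12 * scaleType` at `s = 1 - z`, `|z| ≤ 1`. -/
noncomputable def pushExponent (S : Finset ℕ) (ε : ℝ) (s : ℂ) : ℂ :=
  ε * s + 48 * ∑ γ ∈ S, s / ((√(γ : ℝ) : ℂ) + γ * s)

/-- A map of the unit disc into itself that moves the points near `1` inwards. -/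
noncomputable def pushMap (S : Finset ℕ) (ε : ℝ) (z : ℂ) : ℂ :=
  z * Complex.exp (-pushExponent S ε (1 - z))

/-- If γρ² ≤ 1, extracting the constant 1/(γρ²) lowers the exponent from 1/γ to ρ². Otherwise 1 + u
≤ e^u suffices. -/
theorem one_add_div_le_exp_min {γ ρ x : ℝ} (hγ : 0 < γ) (hρ : 0 < ρ) (hx : 0 ≤ x) :
    1 + x / γ ≤ Real.exp (posLog (1 / (γ * ρ ^ 2)) + min (ρ ^ 2) (1 / γ) * x) := by
  have hρ2 : 0 < ρ ^ 2 := by positivity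
  rcases le_total (ρ ^ 2) (1 / γ) with h | h
  · rw [min_eq_left h, Real.exp_add]
    have h1 : γ * ρ ^ 2 ≤ 1 := by
      rw [le_div_iff₀ hγ] at h
      linarith
    have h2 : 1 ≤ 1 / (γ * ρ ^ 2) := by
      rw [le_div_iff₀ (by positivity)]
      linarith
    rw [Real.posLog_eq_log (by rwa [abs_of_pos (by positivity)]), Real.exp_log (by positivity)]
    calc 1 + x / γ ≤ 1 / (γ * ρ ^ 2) * (1 + ρ ^ 2 * x) := by
          have : 1 / (γ * ρ ^ 2) * (1 + ρ ^ 2 * x) = 1 / (γ * ρ ^ 2) + x / γ := by field_simp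
          rw [this]
          linarith
      _ ≤ _ := by
          gcongr
          linarith [Real.add_one_le_exp (ρ ^ 2 * x)]
  · rw [min_eq_right h]
    refine le_trans ?_ (Real.exp_le_exp.2 (le_add_of_nonneg_left Real.posLog_nonneg))
    have := Real.add_one_le_exp (1 / γ * x)
    rw [one_div_mul_eq_div] at this ⊢
    linarith

theorem one_add_div_le_exp {γ a x : ℝ} (hγ : 1 ≤ γ) (ha : 0 < a) (ha1 : a ≤ 1) (hx : 0 ≤ x) :
    1 + x / γ ≤ Real.exp (Real.log (1 / a) + a * x) := by
  rw [Real.exp_add, Real.exp_log (by positivity)]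
  have h1 : x / γ ≤ x := div_le_self hx hγ
  calc 1 + x / γ ≤ 1 / a * (1 + a * x) := by
        have h2 : 1 / a * (1 + a * x) = 1 / a + x := by field_simp
        have h3 : 1 ≤ 1 / a := by rwa [le_div_iff₀ ha, one_mul]
        rw [h2]
        linarith
    _ ≤ _ := by
        gcongr
        linarith [Real.add_one_le_exp (a * x)]

theorem prod_one_add_div_le {S T : Finset ℕ} (hS : ∀ γ ∈ S, 1 ≤ γ) {ε ρ : ℝ} (hε : 0 < ε)
    (hε1 : ε ≤ 1) (hρ : 0 < ρ) (hρ2 : ρ ≤ 2) {x : ℝ} (hx : 0 ≤ x) :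
    ∏ γ ∈ S, (1 + x / (γ : ℝ)) ≤
      Real.exp (scaleLog (S \ T) T.card ε ρ + scaleType (S \ T) ε ρ * x) := by
  set m := T.card with hm
  -- The factors indexed by T are given the type a each; together they contribute at most ερ²/24,
  -- the last term of `scaleType`, at the cost of log(1/a) per factor in `scaleLog`.
  set a := ε * ρ ^ 2 / (24 * (m + 1)) with ha
  have hm0 : (0 : ℝ) ≤ m := Nat.cast_nonneg m
  have ha0 : 0 < a := by positivity
  have ha1 : a ≤ 1 := by
    rw [ha, div_le_one (by positivity)]
    nlinarith
  have hma : m * a ≤ ε * ρ ^ 2 / 24 := by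
    have : m * a = ε * ρ ^ 2 / 24 * (m / (m + 1)) := by
      rw [ha]
      field_simp
    rw [this]
    refine mul_le_of_le_one_right (by positivity) ?_
    rw [div_le_one (by positivity)]
    linarith
  have hla : 0 ≤ Real.log (1 / a) := Real.log_nonneg (by rwa [le_div_iff₀ ha0, one_mul])
  have hcast : ∀ γ ∈ S, (1 : ℝ) ≤ γ := fun γ hγ => by exact_mod_cast hS γ hγ
  rw [← Finset.prod_sdiff (Finset.inter_subset_left : S ∩ T ⊆ S), Finset.sdiff_inter_self_left]
  have h1 : ∏ γ ∈ S \ T, (1 + x / (γ : ℝ)) ≤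
      Real.exp (∑ γ ∈ S \ T, (posLog (1 / (γ * ρ ^ 2)) + min (ρ ^ 2) (1 / (γ : ℝ)) * x)) := by
    rw [Real.exp_sum]
    refine Finset.prod_le_prod (fun γ _ => by positivity) fun γ hγ => ?_
    exact one_add_div_le_exp_min (by linarith [hcast γ (Finset.mem_sdiff.1 hγ).1]) hρ hx
  have h2 : ∏ γ ∈ S ∩ T, (1 + x / (γ : ℝ)) ≤ Real.exp (m * (Real.log (1 / a) + a * x)) := by
    have h3 : ∏ γ ∈ S ∩ T, (1 + x / (γ : ℝ)) ≤
        Real.exp (∑ _γ ∈ S ∩ T, (Real.log (1 / a) + a * x)) := by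
      rw [Real.exp_sum]
      refine Finset.prod_le_prod (fun γ _ => by positivity) fun γ hγ => ?_
      exact one_add_div_le_exp (hcast γ (Finset.mem_inter.1 hγ).1) ha0 ha1 hx
    refine h3.trans (Real.exp_le_exp.2 ?_)
    rw [Finset.sum_const, nsmul_eq_mul]
    have : ((S ∩ T).card : ℝ) ≤ m := by
      exact_mod_cast Finset.card_le_card Finset.inter_subset_right
    gcongr
  calc _ ≤ Real.exp (∑ γ ∈ S \ T, (posLog (1 / (γ * ρ ^ 2)) + min (ρ ^ 2) (1 / (γ : ℝ)) * x)) *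
        Real.exp (m * (Real.log (1 / a) + a * x)) :=
        mul_le_mul h1 h2 (Finset.prod_nonneg fun γ _ => by positivity) (Real.exp_pos _).le
    _ ≤ _ := by
        rw [← Real.exp_add]
        refine Real.exp_le_exp.2 ?_
        rw [Finset.sum_add_distrib, ← Finset.sum_mul, scaleLog, scaleType]
        have h4 : 1 / a = 24 * (m + 1) / (ε * ρ ^ 2) := by rw [ha, one_div_div]
        rw [← h4]
        nlinarith [mul_le_mul_of_nonneg_right hma hx]

theorem norm_prod_one_add_div_le {S T : Finset ℕ} (hS : ∀ γ ∈ S, 1 ≤ γ) {ε ρ : ℝ} (hε : 0 < ε)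
    (hε1 : ε ≤ 1) (hρ : 0 < ρ) (hρ2 : ρ ≤ 2) (x : ℂ) :
    ‖∏ γ ∈ S, (1 + x / (γ : ℂ))‖ ≤
      Real.exp (scaleLog (S \ T) T.card ε ρ + scaleType (S \ T) ε ρ * ‖x‖) := by
  refine le_trans ?_ (prod_one_add_div_le hS hε hε1 hρ hρ2 (norm_nonneg x))
  rw [norm_prod]
  refine Finset.prod_le_prod (fun _ _ => norm_nonneg _) fun γ _ => ?_
  refine (norm_add_le _ _).trans ?_
  rw [norm_one, norm_div, Complex.norm_natCast]

theorem scaleType_pos {S : Finset ℕ} {ε ρ : ℝ} (hε : 0 < ε) (hρ : 0 < ρ) :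
    0 < scaleType S ε ρ :=
  add_pos_of_nonneg_of_pos (Finset.sum_nonneg fun γ _ => by positivity) (by positivity)

theorem scaleType_ge {S : Finset ℕ} {ε ρ : ℝ} : ε * ρ ^ 2 / 24 ≤ scaleType S ε ρ :=
  le_add_of_nonneg_left (Finset.sum_nonneg fun γ _ => by positivity)

section
variable {S : Finset ℕ} {ε : ℝ} {s z : ℂ}

theorem norm_sqrt_add_mul_ge {γ : ℕ} (hγ : 1 ≤ γ) (hs : 0 ≤ s.re) :
    √(γ : ℝ) ≤ ‖(√(γ : ℝ) : ℂ) + γ * s‖ := by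
  refine le_trans ?_ (Complex.re_le_norm _)
  simp
  positivity

/-- With D the denominator, the real part is (√γ Re s + γ|s|²)/|D|² and |D| ≤ √γ + γ|s|. The two
values of the minimum correspond to √γ|s| ≤ 1, where |D| ≤ 2√γ, and √γ|s| ≥ 1, where |D| ≤ 2γ|s|. -/
theorem re_div_sqrt_add_mul_ge {γ : ℕ} (hγ : 1 ≤ γ) (hs : 0 ≤ s.re) :
    min (‖s‖ ^ 2) (1 / (γ : ℝ)) / 4 ≤ (s / ((√(γ : ℝ) : ℂ) + γ * s)).re := by
  have hγ0 : (0 : ℝ) < γ := by exact_mod_cast hγ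
  set q := √(γ : ℝ) with hq
  have hq0 : 0 < q := Real.sqrt_pos.2 hγ0
  have hq2 : q ^ 2 = γ := Real.sq_sqrt hγ0.le
  set D : ℂ := (q : ℂ) + γ * s with hD
  have hDn : q ≤ ‖D‖ := norm_sqrt_add_mul_ge hγ hs
  have hD0 : 0 < ‖D‖ := hq0.trans_le hDn
  have hre : (s / D).re = (q * s.re + γ * ‖s‖ ^ 2) / ‖D‖ ^ 2 := by
    rw [Complex.div_re, ← Complex.normSq_eq_norm_sq D, ← Complex.normSq_eq_norm_sq s,
      Complex.normSq_apply s, hD]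
    simp
    ring
  rw [hre, le_div_iff₀ (by positivity)]
  have hDle : ‖D‖ ≤ q + q ^ 2 * ‖s‖ := by
    rw [hD]
    refine (norm_add_le _ _).trans ?_
    rw [norm_mul, Complex.norm_real, Complex.norm_natCast, Real.norm_of_nonneg hq0.le, hq2]
  have hmn : 0 ≤ min (‖s‖ ^ 2) (1 / (γ : ℝ)) := by positivity
  have hs0 := norm_nonneg s
  have h1 : min (‖s‖ ^ 2) (1 / (γ : ℝ)) / 4 * (q + q ^ 2 * ‖s‖) ^ 2 ≤ γ * ‖s‖ ^ 2 := by
    rw [← hq2]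
    rcases le_total (q * ‖s‖) 1 with h | h
    · calc min (‖s‖ ^ 2) (1 / (q ^ 2)) / 4 * (q + q ^ 2 * ‖s‖) ^ 2
          ≤ ‖s‖ ^ 2 / 4 * (q + q * 1) ^ 2 := by
            rw [show q ^ 2 * ‖s‖ = q * (q * ‖s‖) by ring]
            gcongr
            exact min_le_left _ _
        _ = _ := by ring
    · calc min (‖s‖ ^ 2) (1 / (q ^ 2)) / 4 * (q + q ^ 2 * ‖s‖) ^ 2
          ≤ (1 / q ^ 2) / 4 * (q * (q * ‖s‖) + q ^ 2 * ‖s‖) ^ 2 := by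
            gcongr
            · exact min_le_right _ _
            · nlinarith
        _ = _ := by field_simp; ring
  calc _ ≤ min (‖s‖ ^ 2) (1 / (γ : ℝ)) / 4 * (q + q ^ 2 * ‖s‖) ^ 2 := by gcongr
    _ ≤ γ * ‖s‖ ^ 2 := h1
    _ ≤ _ := le_add_of_nonneg_left (by positivity)

/-- The factor 48 absorbs the 1/4 lost in `re_div_sqrt_add_mul_ge`, and ε Re s ≥ ε|s|²/2 is exactly
twelve times the last term of `scaleType`. -/
theorem re_pushExponent_ge (hS : ∀ γ ∈ S, 1 ≤ γ) (hε : 0 ≤ ε) (hs : ‖s‖ ^ 2 / 2 ≤ s.re) :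
    12 * scaleType S ε ‖s‖ ≤ (pushExponent S ε s).re := by
  have hs0 : 0 ≤ s.re := le_trans (by positivity) hs
  have h1 : (pushExponent S ε s).re =
      ε * s.re + 48 * ∑ γ ∈ S, (s / ((√(γ : ℝ) : ℂ) + γ * s)).re := by
    simp [pushExponent, Complex.re_sum]
  rw [h1, scaleType, mul_add, add_comm]
  have h2 : ∑ γ ∈ S, min (‖s‖ ^ 2) (1 / (γ : ℝ)) / 4 ≤
      ∑ γ ∈ S, (s / ((√(γ : ℝ) : ℂ) + γ * s)).re :=
    Finset.sum_le_sum fun γ hγ => re_div_sqrt_add_mul_ge (hS γ hγ) hs0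
  rw [← Finset.sum_div] at h2
  nlinarith

theorem norm_pushExponent_le (hS : ∀ γ ∈ S, 1 ≤ γ) (hε : 0 ≤ ε) (hs : 0 ≤ s.re) :
    ‖pushExponent S ε s‖ ≤ (ε + 48 * ∑ γ ∈ S, 1 / √(γ : ℝ)) * ‖s‖ := by
  unfold pushExponent
  refine (norm_add_le _ _).trans ?_
  rw [norm_mul, norm_mul, Complex.norm_real, Real.norm_of_nonneg hε, add_mul, mul_assoc,
    Finset.sum_mul]
  have h48 : ‖(48 : ℂ)‖ = 48 := by simp
  rw [h48]
  gcongr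
  refine norm_sum_le_of_le _ fun γ hγ => ?_
  have h1 := norm_sqrt_add_mul_ge (hS γ hγ) hs
  have h2 : 0 < √(γ : ℝ) := Real.sqrt_pos.2 (by exact_mod_cast hS γ hγ)
  rw [norm_div, one_div_mul_eq_div]
  gcongr

theorem re_one_sub_ge (hz : ‖z‖ ≤ 1) : ‖1 - z‖ ^ 2 / 2 ≤ (1 - z).re := by
  have h1 : ‖z‖ ^ 2 ≤ 1 := by nlinarith [norm_nonneg z]
  rw [← Complex.normSq_eq_norm_sq, Complex.normSq_apply] at h1 ⊢
  simp only [Complex.sub_re, Complex.sub_im, Complex.one_re, Complex.one_im]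
  nlinarith

theorem norm_pushExponent_le_div (hS : ∀ γ ∈ S, 1 ≤ γ) (hε : 0 < ε)
    (hκ : ε + 48 * ∑ γ ∈ S, 1 / √(γ : ℝ) ≤ 1 / 100) (hz : ‖z‖ ≤ 1) :
   
    ‖pushExponent S ε (1 - z)‖ ≤ ‖1 - z‖ / 100 := by
  have h1 := norm_pushExponent_le (s := 1 - z) hS hε.le
    (le_trans (by positivity) (re_one_sub_ge hz))
  have := mul_le_mul_of_nonneg_right hκ (norm_nonneg (1 - z))
  linarith

theorem scaleType_norm_le (hS : ∀ γ ∈ S, 1 ≤ γ) (hε : 0 < ε)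
    (hκ : ε + 48 * ∑ γ ∈ S, 1 / √(γ : ℝ) ≤ 1 / 100) (hz : ‖z‖ ≤ 1) :
    scaleType S ε ‖1 - z‖ ≤ ‖1 - z‖ / 1200 := by
  have h1 := re_pushExponent_ge hS hε.le (re_one_sub_ge hz)
  have h2 := norm_pushExponent_le_div hS hε hκ hz
  have h3 := Complex.re_le_norm (pushExponent S ε (1 - z))
  linarith

/-- The real part x of the exponent is small, so e^{-x} ≤ 1 - x + x² ≤ 1 - x/2. Halving the 12 of
`re_pushExponent_ge` leaves the 6 needed in `norm_multKernel_le`. -/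
theorem norm_pushMap_le (hS : ∀ γ ∈ S, 1 ≤ γ) (hε : 0 < ε)
    (hκ : ε + 48 * ∑ γ ∈ S, 1 / √(γ : ℝ) ≤ 1 / 100) (hz : ‖z‖ ≤ 1) :
    ‖pushMap S ε z‖ ≤ 1 - 6 * scaleType S ε ‖1 - z‖ := by
  have h1 := re_pushExponent_ge hS hε.le (re_one_sub_ge hz)
  have h2 := norm_pushExponent_le_div hS hε hκ hz
  have h3 := Complex.re_le_norm (pushExponent S ε (1 - z))
  have h4 : ‖1 - z‖ ≤ 2 := (norm_sub_le _ _).trans (by rw [norm_one]; linarith)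
  have h5 : 0 ≤ (pushExponent S ε (1 - z)).re := by
    refine le_trans ?_ h1
    have : (0 : ℝ) ≤ scaleType S ε ‖1 - z‖ := le_trans (by positivity) scaleType_ge
    linarith
  set x := (pushExponent S ε (1 - z)).re with hx
  rw [pushMap, norm_mul, Complex.norm_exp, Complex.neg_re, ← hx]
  have h6 : Real.exp (-x) ≤ 1 - x / 2 := by
    have h7 := Real.abs_exp_sub_one_sub_id_le (x := -x) (by rw [abs_neg, abs_of_nonneg h5]; linarith)
    have h8 := (abs_le.1 h7).2
    nlinarith
  calc ‖z‖ * Real.exp (-x) ≤ 1 * Real.exp (-x) := by gcongr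
    _ ≤ _ := by linarith

theorem norm_pushMap_sub_le (hS : ∀ γ ∈ S, 1 ≤ γ) (hε : 0 < ε)
    (hκ : ε + 48 * ∑ γ ∈ S, 1 / √(γ : ℝ) ≤ 1 / 100) (hz : ‖z‖ ≤ 1) :
    ‖pushMap S ε z - z‖ ≤ ‖1 - z‖ / 50 := by
  have h2 := norm_pushExponent_le_div hS hε hκ hz
  have h4 : ‖1 - z‖ ≤ 2 := (norm_sub_le _ _).trans (by rw [norm_one]; linarith)
  have h3 : pushMap S ε z - z = z * (Complex.exp (-pushExponent S ε (1 - z)) - 1) := by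
    rw [pushMap]
    ring
  have h5 := Complex.norm_exp_sub_one_le (x := -pushExponent S ε (1 - z))
    (by rw [norm_neg]; linarith)
  rw [norm_neg] at h5
  rw [h3, norm_mul]
  calc ‖z‖ * ‖Complex.exp (-pushExponent S ε (1 - z)) - 1‖
      ≤ 1 * (2 * ‖pushExponent S ε (1 - z)‖) := by gcongr
    _ ≤ _ := by linarith

theorem differentiableOn_pushMap (hS : ∀ γ ∈ S, 1 ≤ γ) :
    DifferentiableOn ℂ (pushMap S ε) (Metric.ball 0 1) := by
  intro z hz
  rw [mem_ball_zero_iff] at hz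
  have h1 : 0 ≤ (1 - z).re := le_trans (by positivity) (re_one_sub_ge hz.le)
  refine DifferentiableAt.differentiableWithinAt ?_
  unfold pushMap pushExponent
  have h2 : DifferentiableAt ℂ
      (fun z => ∑ γ ∈ S, (1 - z) / ((√(γ : ℝ) : ℂ) + γ * (1 - z))) z := by
    refine DifferentiableAt.fun_sum fun γ hγ => ?_
    have h3 := norm_sqrt_add_mul_ge (hS γ hγ) h1
    have h4 : 0 < √(γ : ℝ) := Real.sqrt_pos.2 (by exact_mod_cast hS γ hγ)
    have h5 : (√(γ : ℝ) : ℂ) + γ * (1 - z) ≠ 0 := norm_pos_iff.1 (h4.trans_le h3)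
    fun_prop (disch := assumption)
  fun_prop

end

theorem pushMap_zero (S : Finset ℕ) (ε : ℝ) : pushMap S ε 0 = 0 := by
  simp [pushMap]

/-! ### Distances on the circle -/

theorem norm_circlePt_sub_circlePt (t s : ℝ) :
    ‖circlePt t - circlePt s‖ = 2 * |Real.sin (Real.pi * (t - s))| := by
  have h1 : circlePt t - circlePt s =
      circlePt s * (Complex.exp (Complex.I * ((2 * Real.pi * (t - s) : ℝ) : ℂ)) - 1) := by
    rw [mul_sub, mul_one, circlePt, circlePt, ← Complex.exp_add]
    congr 2
    push_cast
    ring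
  rw [h1, norm_mul, norm_circlePt, one_mul, Complex.norm_exp_I_mul_ofReal_sub_one, norm_mul,
    Real.norm_eq_abs, Real.norm_eq_abs, abs_two]
  congr 3
  ring

theorem circlePt_zero : circlePt 0 = 1 := by simp [circlePt]

theorem two_mul_le_sin_pi_mul {t : ℝ} (h0 : 0 ≤ t) (h1 : t ≤ 1 / 2) :
    2 * t ≤ Real.sin (Real.pi * t) := by
  have hpi := Real.pi_pos
  have h := Real.mul_le_sin (x := Real.pi * t) (by positivity) (by nlinarith)
  have h2 : 2 / Real.pi * (Real.pi * t) = 2 * t := by field_simp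
  linarith

theorem min_le_norm_one_sub {t r : ℝ} (ht : t ∈ Ioo (0 : ℝ) 1) (hr0 : 0 ≤ r) (hr1 : r ≤ 1) :
    min t (1 - t) ≤ ‖1 - r * circlePt t‖ := by
  have h1 : ‖(r : ℂ) * circlePt t‖ = r := by
    rw [norm_mul, norm_circlePt, Complex.norm_real, Real.norm_of_nonneg hr0, mul_one]
  have h2 : 1 - r ≤ ‖1 - r * circlePt t‖ := by
    have := norm_sub_norm_le (1 : ℂ) (r * circlePt t)
    rwa [norm_one, h1] at this
  have h3 : ‖circlePt t - 1‖ ≤ ‖1 - r * circlePt t‖ + (1 - r) := by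
    have e : circlePt t - 1 = -(1 - r * circlePt t) + (1 - r : ℝ) * circlePt t := by
      push_cast
      ring
    rw [e]
    refine (norm_add_le _ _).trans ?_
    rw [norm_neg, norm_mul, norm_circlePt, Complex.norm_real, mul_one,
      Real.norm_of_nonneg (by linarith)]
  have h4 := norm_circlePt_sub_circlePt t 0
  rw [circlePt_zero, sub_zero] at h4
  have h5 : min t (1 - t) ≤ |Real.sin (Real.pi * t)| := by
    refine le_trans ?_ (le_abs_self _)
    rcases le_total t (1 / 2) with h | h
    · have := two_mul_le_sin_pi_mul ht.1.le h
      linarith [min_le_left t (1 - t), ht.1]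
    · have := two_mul_le_sin_pi_mul (t := 1 - t) (by linarith [ht.2]) (by linarith)
      rw [show Real.pi * (1 - t) = Real.pi - Real.pi * t by ring, Real.sin_pi_sub] at this
      linarith [min_le_right t (1 - t), ht.2]
  linarith

/-- On the circle, the arc `[2s, 1)` is at least as far from `s` as the origin is. -/
theorem norm_circlePt_sub_one_le {s t : ℝ} (hs : 0 < s) (hs1 : s ≤ 1 / 4) (ht : t ∈ Ico (2 * s) 1) :
    ‖circlePt s - 1‖ ≤ ‖circlePt t - circlePt s‖ := by
  have hpi := Real.pi_pos
  have h4 := norm_circlePt_sub_circlePt s 0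
  rw [circlePt_zero, sub_zero] at h4
  rw [h4, norm_circlePt_sub_circlePt,
    abs_of_nonneg (Real.sin_nonneg_of_nonneg_of_le_pi (by positivity) (by nlinarith))]
  have h5 : Real.sin (Real.pi * s) ≤ Real.sin (Real.pi * (t - s)) := by
    rcases le_total (t - s) (1 / 2) with h | h
    · refine Real.sin_le_sin_of_le_of_le_pi_div_two (by nlinarith) (by nlinarith) ?_
      have := ht.1
      gcongr
      linarith
    · rw [← Real.sin_pi_sub (Real.pi * (t - s))]
      have := ht.2
      refine Real.sin_le_sin_of_le_of_le_pi_div_two (by nlinarith) (by nlinarith) ?_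
      nlinarith
  have := le_abs_self (Real.sin (Real.pi * (t - s)))
  linarith

/-! ### Estimates for the transform at the pushed points -/

section
variable {g : ℝ → ℂ} {S T : Finset ℕ} {ε : ℝ} {b : ℕ → ℝ} {m : ℕ}

theorem norm_sum_risingBinom_le (hS : ∀ γ ∈ S, 1 ≤ γ) (hε : 0 < ε) (hε1 : ε ≤ 1)
    (hP : ∀ x : ℂ, ∏ γ ∈ S, (1 + x / (γ : ℂ)) =
      ∑ k ∈ Finset.range (m + 1), (b k : ℂ) * risingBinom k x)
    {ρ : ℝ} (hρ : 0 < ρ) (hρ2 : ρ ≤ 2) (x : ℝ) (hx : 0 ≤ x) :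
    ‖∑ k ∈ Finset.range (m + 1), (b k : ℂ) * risingBinom k (x : ℂ)‖ ≤
      Real.exp (scaleLog (S \ T) T.card ε ρ + scaleType (S \ T) ε ρ * x) := by
  have h := norm_prod_one_add_div_le (T := T) hS hε hε1 hρ hρ2 (x : ℂ)
  rwa [Complex.norm_real, Real.norm_of_nonneg hx, hP] at h

/-- The whole circle lies at distance at least `6 * scaleType` from the pushed point, so the kernel
estimate applies for every t. No smallness of g is used; this bound serves wherever there is nothing
to gain. -/
theorem norm_multTransform_pushMap_le (hS : ∀ γ ∈ S, 1 ≤ γ) (hε : 0 < ε)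
    (hκ : ε + 48 * ∑ γ ∈ S \ T, 1 / √(γ : ℝ) ≤ 1 / 100) (hε1 : ε ≤ 1) (hb : ∀ k, 0 ≤ b k)
    (hP : ∀ x : ℂ, ∏ γ ∈ S, (1 + x / (γ : ℂ)) =
      ∑ k ∈ Finset.range (m + 1), (b k : ℂ) * risingBinom k x)
    {A : Set ℝ} (hA : MeasurableSet A) (hg : IntegrableOn g A) {z : ℂ} (hz : ‖z‖ < 1) :
    ‖multTransform b m g A (pushMap (S \ T) ε z)‖ ≤
      8 * Real.exp (scaleLog (S \ T) T.card ε ‖1 - z‖) / (ε * ‖1 - z‖ ^ 2) * ∫ t in A, ‖g t‖ := by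
  have hST : ∀ γ ∈ S \ T, 1 ≤ γ := fun γ hγ => hS γ (Finset.mem_sdiff.1 hγ).1
  have hρ : 0 < ‖1 - z‖ := by
    refine norm_pos_iff.2 fun h => ?_
    rw [← sub_eq_zero.1 h, norm_one] at hz
    exact lt_irrefl _ hz
  have hρ2 : ‖1 - z‖ ≤ 2 := (norm_sub_le _ _).trans (by rw [norm_one]; linarith)
  have hy : 0 < scaleType (S \ T) ε ‖1 - z‖ := scaleType_pos hε hρ
  have hd : ∀ t ∈ A, 6 * scaleType (S \ T) ε ‖1 - z‖ ≤ ‖circlePt t - pushMap (S \ T) ε z‖ := by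
    intro t _
    have h1 := norm_pushMap_le hST hε hκ hz.le
    have h2 := norm_sub_norm_le (circlePt t) (pushMap (S \ T) ε z)
    rw [norm_circlePt] at h2
    linarith
  refine (norm_multTransform_le hb hy (norm_sum_risingBinom_le (T := T) hS hε hε1 hP hρ hρ2) hA hg
    le_rfl hd).trans ?_
  have h3 : ε * ‖1 - z‖ ^ 2 / 24 ≤ scaleType (S \ T) ε ‖1 - z‖ := scaleType_ge
  have h4 : 0 ≤ ∫ t in A, ‖g t‖ := integral_nonneg fun t => norm_nonneg _
  refine mul_le_mul_of_nonneg_right ?_ h4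
  rw [div_le_div_iff₀ (by positivity) (by positivity)]
  nlinarith [Real.exp_pos (scaleLog (S \ T) T.card ε ‖1 - z‖)]

theorem differentiableOn_multTransform (b : ℕ → ℝ) (m : ℕ) {A : Set ℝ} (hA : MeasurableSet A)
    (hg : IntegrableOn g A) : DifferentiableOn ℂ (multTransform b m g A) (Metric.ball 0 1) := by
  intro z hz
  rw [mem_ball_zero_iff] at hz
  refine DifferentiableAt.differentiableWithinAt ?_
  refine differentiableAt_multTransform b m hA hg (δ := (1 - ‖z‖) / 2) (by linarith) ?_
  intro v hv t _
  rw [Metric.mem_ball, dist_eq_norm] at hv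
  have h1 := norm_sub_norm_le v z
  have h2 := norm_sub_norm_le (circlePt t) v
  rw [norm_circlePt] at h2
  linarith

/-- If `g` is small on `(0, 2s)`, so is its transform at the image of a point near `s`. -/
theorem norm_multTransform_pushMap_le_of_small (hS : ∀ γ ∈ S, 1 ≤ γ) (hε : 0 < ε)
    (hκ : ε + 48 * ∑ γ ∈ S \ T, 1 / √(γ : ℝ) ≤ 1 / 100) (hε1 : ε ≤ 1) (hb : ∀ k, 0 ≤ b k)
    (hP : ∀ x : ℂ, ∏ γ ∈ S, (1 + x / (γ : ℂ)) =
      ∑ k ∈ Finset.range (m + 1), (b k : ℂ) * risingBinom k x)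
    (hg : IntegrableOn g (Ioo 0 1)) {r s G W η : ℝ} (hr0 : 0 ≤ r) (hr1 : r < 1) (hs : 0 < s)
    (hs1 : s ≤ 1 / 4) (hrs : 100 * (1 - r) ≤ ‖1 - r * circlePt s‖) (hG : 1 ≤ G) (hW : 1 ≤ W)
    (hη : 0 ≤ η) (hηW : η ≤ W) (hgG : ∫ t in Ioo (0 : ℝ) 1, ‖g t‖ ≤ G)
    (hgη : ∫ t in Ioo 0 (2 * s), ‖g t‖ ≤ G * η ^ 4)
    (hout : ∀ v : ℂ, 1 + ‖1 - r * circlePt s‖ / 25 ≤ ‖v‖ →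
      ‖multTransform b m g (Ioo 0 1) v‖ ≤ η ^ 4) :
    ‖multTransform b m g (Ioo 0 1) (pushMap (S \ T) ε (r * circlePt s))‖ ≤
      24 * G * W ^ 3 / (ε * ‖1 - r * circlePt s‖ ^ 2) *
        Real.exp (scaleLog (S \ T) T.card ε ‖1 - r * circlePt s‖) * η := by
  have hST : ∀ γ ∈ S \ T, 1 ≤ γ := fun γ hγ => hS γ (Finset.mem_sdiff.1 hγ).1
  set z : ℂ := r * circlePt s with hzdef
  have hznorm : ‖z‖ = r := by
    rw [hzdef, norm_mul, norm_circlePt, Complex.norm_real, Real.norm_of_nonneg hr0, mul_one]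
  have hz : ‖z‖ < 1 := by rw [hznorm]; exact hr1
  set ρ := ‖1 - z‖ with hρdef
  have hρ : 0 < ρ := by linarith
  have hρ2 : ρ ≤ 2 := (norm_sub_le _ _).trans (by rw [norm_one]; linarith)
  set B := scaleLog (S \ T) T.card ε ρ with hB
  set y := scaleType (S \ T) ε ρ with hy
  have hy0 : 0 < y := scaleType_pos hε hρ
  have hyρ : y ≤ ρ / 1200 := scaleType_norm_le hST hε hκ hz.le
  have hPB := norm_sum_risingBinom_le (T := T) hS hε hε1 hP hρ hρ2
  have hB1 : 1 ≤ Real.exp B := by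
    have h1 := hPB 0 le_rfl
    rw [Complex.ofReal_zero, ← hP] at h1
    simpa using h1
  set w := pushMap (S \ T) ε z with hw
  have hwz : ‖w - z‖ ≤ ρ / 50 := norm_pushMap_sub_le hST hε hκ hz.le
  have hzs : ‖circlePt s - z‖ = 1 - r := by
    have : circlePt s - z = ((1 - r : ℝ) : ℂ) * circlePt s := by
      rw [hzdef]
      push_cast
      ring
    rw [this, norm_mul, norm_circlePt, mul_one, Complex.norm_real,
      Real.norm_of_nonneg (by linarith)]
  have hd0 : ρ - (1 - r) ≤ ‖circlePt s - 1‖ := by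
    have h1 : (1 - z) = -(circlePt s - 1) + (circlePt s - z) := by ring
    have h2 := norm_add_le (-(circlePt s - 1)) (circlePt s - z)
    rw [← h1, norm_neg, hzs] at h2
    linarith
  have hwn : 1 - (1 - r) - ρ / 50 ≤ ‖w‖ := by
    have h1 := norm_sub_norm_le z w
    rw [norm_sub_rev, hznorm] at h1
    linarith
  have hunion : Ioo (0 : ℝ) 1 = Ioo 0 (2 * s) ∪ Ico (2 * s) 1 :=
    (Ioo_union_Ico_eq_Ioo (by linarith) (by linarith)).symm
  have hdisj : Disjoint (Ioo 0 (2 * s)) (Ico (2 * s) 1) :=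
    Set.disjoint_left.2 fun t h1 h2 => absurd h1.2 (not_lt.2 h2.1)
  have hg1 : IntegrableOn g (Ioo 0 (2 * s)) :=
    hg.mono_set (by rw [hunion]; exact subset_union_left)
  have hg2 : IntegrableOn g (Ico (2 * s) 1) :=
    hg.mono_set (by rw [hunion]; exact subset_union_right)
  have hgfar : ∫ t in Ico (2 * s) 1, ‖g t‖ ≤ G :=
    (setIntegral_mono_set hg.norm (Filter.Eventually.of_forall fun t => norm_nonneg _)
      (by rw [hunion]; exact (subset_union_right).eventuallyLE)).trans hgG
  have hadd : ∀ v : ℂ, ‖v‖ ≠ 1 → multTransform b m g (Ioo 0 1) v =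
      multTransform b m g (Ioo 0 (2 * s)) v + multTransform b m g (Ico (2 * s) 1) v := by
    intro v hv
    rw [hunion]
    refine multTransform_union measurableSet_Ioo measurableSet_Ico hdisj (by rwa [← hunion])
      (δ := |1 - ‖v‖|) (abs_pos.2 (sub_ne_zero.2 hv.symm)) fun t _ => ?_
    have := abs_norm_sub_norm_le (circlePt t) v
    rwa [norm_circlePt] at this
  -- The arc [2s, 1) stays at distance nearly ρ from the point s of the circle, hence from the disc
  -- about w. The far part is therefore analytic on this disc although the disc crosses the unit
  -- circle.
  have hfardist : ∀ v ∈ Metric.closedBall w (ρ / 10), ∀ t ∈ Ico (2 * s) 1,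
      4 / 5 * ρ ≤ ‖circlePt t - v‖ := by
    intro v hv t ht
    rw [Metric.mem_closedBall, dist_eq_norm] at hv
    have h1 := norm_circlePt_sub_one_le hs hs1 ht
    have h2 : circlePt t - circlePt s =
        (circlePt t - v) + (v - w) + ((w - z) - (circlePt s - z)) := by ring
    have h3 : ‖circlePt t - circlePt s‖ ≤
        ‖circlePt t - v‖ + ‖v - w‖ + (‖w - z‖ + ‖circlePt s - z‖) := by
      rw [h2]
      refine (norm_add_le _ _).trans (add_le_add (norm_add_le _ _) (norm_sub_le _ _))
    rw [hzs] at h3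
    linarith
  have hfar : ‖multTransform b m g (Ico (2 * s) 1) w‖ ^ 4 ≤
      (4 * Real.exp B * G / ρ) ^ 3 * (52 * Real.exp B * G * η ^ 4 / ρ) := by
    refine norm_pow_four_le (R := ρ / 10) (by positivity) ?_ ?_ ?_
    · intro v hv
      refine differentiableAt_multTransform b m measurableSet_Ico hg2 (δ := ρ / 4) (by positivity) ?_
      intro u hu t ht
      rw [Metric.mem_ball, dist_eq_norm] at hu
      have h1 := hfardist v hv t ht
      have h2 : circlePt t - v = (circlePt t - u) + (u - v) := by ring
      rw [h2] at h1
      have h3 := norm_add_le (circlePt t - u) (u - v)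
      linarith
    · intro v hv
      refine (norm_multTransform_le hb hy0 hPB measurableSet_Ico hg2 (d := 4 / 5 * ρ) (by linarith)
        (hfardist v hv)).trans ?_
      calc 2 * Real.exp B / (4 / 5 * ρ) * ∫ t in Ico (2 * s) 1, ‖g t‖
          ≤ 2 * Real.exp B / (4 / 5 * ρ) * G := by gcongr
        _ ≤ 4 * Real.exp B * G / ρ := by
          rw [div_mul_eq_mul_div, div_le_div_iff₀ (by positivity) hρ]
          have : 0 < Real.exp B * G * ρ := by positivity
          nlinarith
    · intro v hv hvn
      -- The losses are ρ/100 from 1 - r and ρ/50 from the push, against a gain of 7ρ/100: exactly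
      -- ρ/25 remains. Out there the far part is the full transform, small by `hout`, minus the near
      -- part, small by `hgη`.
      have hv1 : 1 + ρ / 25 ≤ ‖v‖ := by linarith
      have h1 := hadd v (by linarith [hρ] : (1 : ℝ) < ‖v‖).ne'
      have h2 : multTransform b m g (Ico (2 * s) 1) v =
          multTransform b m g (Ioo 0 1) v - multTransform b m g (Ioo 0 (2 * s)) v := by
        rw [h1]
        ring
      have h3 : ‖multTransform b m g (Ioo 0 (2 * s)) v‖ ≤
          2 * Real.exp B / (ρ / 25) * ∫ t in Ioo 0 (2 * s), ‖g t‖ := by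
        refine norm_multTransform_le hb hy0 hPB measurableSet_Ioo hg1 (by linarith) fun t _ => ?_
        have h4 := norm_sub_norm_le v (circlePt t)
        rw [norm_circlePt, norm_sub_rev] at h4
        linarith
      have h4 : 2 * Real.exp B / (ρ / 25) * ∫ t in Ioo 0 (2 * s), ‖g t‖ ≤
          50 * Real.exp B * G * η ^ 4 / ρ := by
        calc _ ≤ 2 * Real.exp B / (ρ / 25) * (G * η ^ 4) := by gcongr
          _ = _ := by field_simp; ring
      have h5 : η ^ 4 ≤ 2 * Real.exp B * G * η ^ 4 / ρ := by
        rw [le_div_iff₀ hρ]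
        have h6 : 1 ≤ Real.exp B * G := one_le_mul_of_one_le_of_one_le hB1 hG
        have h7 : 0 ≤ η ^ 4 := by positivity
        nlinarith [mul_le_mul_of_nonneg_right h6 h7]
      rw [h2]
      refine (norm_sub_le _ _).trans ?_
      have h8 := hout v hv1
      have h9 : 52 * Real.exp B * G * η ^ 4 / ρ =
          2 * Real.exp B * G * η ^ 4 / ρ + 50 * Real.exp B * G * η ^ 4 / ρ := by ring
      linarith
  have hfar' : ‖multTransform b m g (Ico (2 * s) 1) w‖ ≤ 8 * Real.exp B * G * η / ρ := by
    refine le_of_pow_le_pow_left₀ (n := 4) (by norm_num) (by positivity) (hfar.trans ?_)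
    have h1 : 0 ≤ (Real.exp B * G * η / ρ) ^ 4 := by positivity
    calc _ = 3328 * (Real.exp B * G * η / ρ) ^ 4 := by ring
      _ ≤ 4096 * (Real.exp B * G * η / ρ) ^ 4 := by linarith
      _ = _ := by ring
  have hnear := norm_multTransform_pushMap_le (T := T) hS hε hκ hε1 hb hP measurableSet_Ioo hg1 hz
  have hw1 : ‖w‖ < 1 := by
    have := norm_pushMap_le hST hε hκ hz.le
    linarith
  rw [hadd w hw1.ne]
  refine (norm_add_le _ _).trans ?_
  -- The near part has η⁴ to spare, but the fourth root taken for the far part leaves only η.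
  -- Trading η³ for W³ gives both the same shape.
  have hW3 : 1 ≤ W ^ 3 := one_le_pow₀ hW
  have h1 : ‖multTransform b m g (Ioo 0 (2 * s)) w‖ ≤
      8 * (G * W ^ 3 / (ε * ρ ^ 2) * Real.exp B * η) := by
    refine hnear.trans ?_
    calc 8 * Real.exp B / (ε * ρ ^ 2) * ∫ t in Ioo 0 (2 * s), ‖g t‖
        ≤ 8 * Real.exp B / (ε * ρ ^ 2) * (G * (η ^ 3 * η)) := by
          gcongr
          rw [← pow_succ]
          exact hgη
      _ ≤ 8 * Real.exp B / (ε * ρ ^ 2) * (G * (W ^ 3 * η)) := by gcongr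
      _ = _ := by ring
  have h2 : 8 * Real.exp B * G * η / ρ ≤ 16 * (G * W ^ 3 / (ε * ρ ^ 2) * Real.exp B * η) := by
    have h3 : 16 * (G * W ^ 3 / (ε * ρ ^ 2) * Real.exp B * η) =
        8 * Real.exp B * G * η / ρ * (W ^ 3 * (2 / (ε * ρ))) := by
      field_simp
      ring
    rw [h3]
    refine le_mul_of_one_le_right (by positivity) ?_
    refine one_le_mul_of_one_le_of_one_le hW3 ?_
    rw [le_div_iff₀ (by positivity)]
    nlinarith
  calc _ ≤ 8 * (G * W ^ 3 / (ε * ρ ^ 2) * Real.exp B * η) +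
        16 * (G * W ^ 3 / (ε * ρ ^ 2) * Real.exp B * η) := add_le_add h1 (hfar'.trans h2)
    _ = _ := by ring
end

/-! ### The logarithmic majorant and its integral -/

theorem integral_log_div_mul_sq {a e : ℝ} (ha : 0 < a) (he : 0 < e) :
    IntervalIntegrable (fun t => Real.log (a / (e * t ^ 2))) volume 0 1 ∧
      ∫ t in (0 : ℝ)..1, Real.log (a / (e * t ^ 2)) = Real.log (a / e) + 2 := by
  have hcongr : ∀ t ∈ uIoc (0 : ℝ) 1, Real.log (a / e) - 2 * Real.log t =
      Real.log (a / (e * t ^ 2)) := by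
    intro t ht
    rw [uIoc_of_le zero_le_one] at ht
    have := ht.1
    rw [← div_div, Real.log_div (x := a / e) (by positivity) (by positivity), Real.log_pow]
    norm_num
  have hint : IntervalIntegrable (fun t => Real.log (a / e) - 2 * Real.log t) volume 0 1 :=
    intervalIntegrable_const.sub (intervalIntegral.intervalIntegrable_log'.const_mul 2)
  refine ⟨hint.congr hcongr, ?_⟩
  rw [← intervalIntegral.integral_congr_ae (.of_forall hcongr), intervalIntegral.integral_sub
    intervalIntegrable_const (intervalIntegral.intervalIntegrable_log'.const_mul 2),
    intervalIntegral.integral_const_mul, integral_log]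
  simp

/-- With c = 1/√γ the integrand is 2 log(c/t) up to c and zero afterwards. This is the source of the
exponent 1/2 in the condition on Γ. -/
theorem integral_posLog_div_mul_sq {γ : ℝ} (hγ : 1 ≤ γ) :
    IntervalIntegrable (fun t => posLog (1 / (γ * t ^ 2))) volume 0 1 ∧
      ∫ t in (0 : ℝ)..1, posLog (1 / (γ * t ^ 2)) = 2 * (1 / √γ) := by
  have hγ0 : 0 < γ := by linarith
  set c := 1 / √γ with hc
  have hsq : 1 ≤ √γ := Real.one_le_sqrt.2 hγ
  have hc0 : 0 < c := by positivity
  have hc1 : c ≤ 1 := by rwa [hc, div_le_one (by positivity)]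
  have hc2 : c ^ 2 = 1 / γ := by rw [hc, div_pow, Real.sq_sqrt hγ0.le, one_pow]
  have heq : ∀ t, 1 / (γ * t ^ 2) = c ^ 2 / t ^ 2 := by
    intro t
    rw [hc2, div_div]
  simp only [heq]
  have h1 : ∀ t ∈ uIoc 0 c, 2 * Real.log c - 2 * Real.log t = posLog (c ^ 2 / t ^ 2) := by
    intro t ht
    rw [uIoc_of_le hc0.le] at ht
    have ht0 := ht.1
    rw [Real.posLog_eq_log, Real.log_div (x := c ^ 2) (by positivity) (by positivity),
      Real.log_pow, Real.log_pow]
    · norm_num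
    · rw [abs_of_pos (by positivity), le_div_iff₀ (by positivity), one_mul]
      exact pow_le_pow_left₀ ht0.le ht.2 2
  have h2 : ∀ t ∈ uIoc c 1, (0 : ℝ) = posLog (c ^ 2 / t ^ 2) := by
    intro t ht
    rw [uIoc_of_le hc1] at ht
    have ht0 : 0 < t := hc0.trans ht.1
    rw [eq_comm, Real.posLog_eq_zero_iff, abs_of_pos (by positivity), div_le_one (by positivity)]
    exact pow_le_pow_left₀ hc0.le ht.1.le 2
  have hint : IntervalIntegrable (fun t => 2 * Real.log c - 2 * Real.log t) volume 0 c :=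
    intervalIntegrable_const.sub (intervalIntegral.intervalIntegrable_log'.const_mul 2)
  have hi1 := hint.congr h1
  have hi2 : IntervalIntegrable (fun t => posLog (c ^ 2 / t ^ 2)) volume c 1 :=
    (intervalIntegrable_const (c := (0 : ℝ))).congr h2
  refine ⟨hi1.trans hi2, ?_⟩
  rw [← intervalIntegral.integral_add_adjacent_intervals hi1 hi2,
    ← intervalIntegral.integral_congr_ae (.of_forall h1), ← intervalIntegral.integral_congr_ae (.of_forall h2),
    intervalIntegral.integral_sub intervalIntegrable_const
      (intervalIntegral.intervalIntegrable_log'.const_mul 2),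
    intervalIntegral.integral_const_mul 2 Real.log, integral_log]
  simp
  ring

/-- The logarithm of the bound for the transform at distance `ρ` from `1`. -/
noncomputable def logMajorant (S : Finset ℕ) (m : ℕ) (ε a ρ : ℝ) : ℝ :=
  scaleLog S m ε ρ + Real.log (a / (ε * ρ ^ 2))

section
variable {S : Finset ℕ} {m : ℕ} {ε a : ℝ}

theorem logMajorant_anti (hS : ∀ γ ∈ S, 1 ≤ γ) (hε : 0 < ε) (ha : 0 < a) {ρ ρ' : ℝ} (hρ : 0 < ρ)
    (h : ρ ≤ ρ') : logMajorant S m ε a ρ' ≤ logMajorant S m ε a ρ := by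
  have hρ' : 0 < ρ' := hρ.trans_le h
  unfold logMajorant scaleLog
  have hs : ∀ γ ∈ S, posLog (1 / ((γ : ℝ) * ρ' ^ 2)) ≤ posLog (1 / (γ * ρ ^ 2)) := by
    intro γ hγ
    have h1 : (0 : ℝ) < γ := by exact_mod_cast hS γ hγ
    exact Real.posLog_le_posLog (by positivity) (by gcongr)
  have h2 : ∀ A : ℝ, 0 < A → Real.log (A / (ε * ρ' ^ 2)) ≤ Real.log (A / (ε * ρ ^ 2)) :=
    fun A hA => Real.log_le_log (by positivity) (by gcongr)
  exact add_le_add (add_le_add (Finset.sum_le_sum hs)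
    (mul_le_mul_of_nonneg_left (h2 _ (by positivity)) (Nat.cast_nonneg m))) (h2 a ha)

theorem logMajorant_nonneg (hε : 0 < ε) (hε1 : ε ≤ 1) (ha : 1 ≤ a) {ρ : ℝ}
    (hρ : 0 < ρ) (hρ1 : ρ ≤ 1) : 0 ≤ logMajorant S m ε a ρ := by
  have h1 : ε * ρ ^ 2 ≤ 1 := mul_le_one₀ hε1 (by positivity) (pow_le_one₀ hρ.le hρ1)
  have h2 : 0 < ε * ρ ^ 2 := by positivity
  have hm : (0 : ℝ) ≤ m := Nat.cast_nonneg m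
  refine add_nonneg (add_nonneg (Finset.sum_nonneg fun γ _ => Real.posLog_nonneg)
    (mul_nonneg hm (Real.log_nonneg ?_))) (Real.log_nonneg ?_)
  · rw [le_div_iff₀ h2]
    nlinarith
  · rw [le_div_iff₀ h2]
    linarith

theorem integral_logMajorant (hS : ∀ γ ∈ S, 1 ≤ γ) (hε : 0 < ε) (ha : 0 < a) :
    IntervalIntegrable (logMajorant S m ε a) volume 0 1 ∧
      ∫ t in (0 : ℝ)..1, logMajorant S m ε a t = 2 * ∑ γ ∈ S, 1 / √(γ : ℝ) +
        (m * (Real.log (24 * (m + 1) / ε) + 2) + (Real.log (a / ε) + 2)) := by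
  have h1 : ∀ γ ∈ S, (1 : ℝ) ≤ γ := fun γ hγ => by exact_mod_cast hS γ hγ
  have i1 : ∀ γ ∈ S, IntervalIntegrable (fun t => posLog (1 / ((γ : ℝ) * t ^ 2))) volume 0 1 :=
    fun γ hγ => (integral_posLog_div_mul_sq (h1 γ hγ)).1
  have i2 : IntervalIntegrable (fun t => ∑ γ ∈ S, posLog (1 / ((γ : ℝ) * t ^ 2))) volume 0 1 := by
    have := IntervalIntegrable.sum S i1
    exact this.congr fun t _ => by simp
  have h24 : (0 : ℝ) < 24 * (m + 1) := by positivity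
  obtain ⟨i3, e3⟩ := integral_log_div_mul_sq h24 hε
  obtain ⟨i4, e4⟩ := integral_log_div_mul_sq ha hε
  unfold logMajorant scaleLog
  refine ⟨(i2.add (i3.const_mul m)).add i4, ?_⟩
  rw [intervalIntegral.integral_add (i2.add (i3.const_mul m)) i4,
    intervalIntegral.integral_add i2 (i3.const_mul m), intervalIntegral.integral_const_mul, e3, e4,
    intervalIntegral.integral_finsetSum i1, Finset.mul_sum,
    Finset.sum_congr rfl fun γ hγ => (integral_posLog_div_mul_sq (h1 γ hγ)).2]
  ring

/-- A minimum is at most the geometric mean: min(ρ², 1/γ) ≤ ρ/√γ. -/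
theorem scaleType_le_self (hS : ∀ γ ∈ S, 1 ≤ γ) (hε1 : ε ≤ 1)
    (hsum : ∑ γ ∈ S, 1 / √(γ : ℝ) ≤ 1 / 2) {ρ : ℝ} (hρ : 0 ≤ ρ) (hρ1 : ρ ≤ 1) :
    scaleType S ε ρ ≤ ρ := by
  have h1 : ∑ γ ∈ S, min (ρ ^ 2) (1 / (γ : ℝ)) ≤ ∑ γ ∈ S, ρ * (1 / √(γ : ℝ)) := by
    refine Finset.sum_le_sum fun γ hγ => ?_
    have h0 : (0 : ℝ) < √(γ : ℝ) := Real.sqrt_pos.2 (by exact_mod_cast hS γ hγ)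
    have h2 : 1 / (γ : ℝ) = (1 / √(γ : ℝ)) ^ 2 := by
      rw [div_pow, Real.sq_sqrt (Nat.cast_nonneg γ), one_pow]
    rw [h2]
    have h3 : 0 < 1 / √(γ : ℝ) := by positivity
    rcases le_total ρ (1 / √(γ : ℝ)) with h | h
    · exact (min_le_left _ _).trans (by nlinarith)
    · exact (min_le_right _ _).trans (by nlinarith)
  rw [← Finset.mul_sum] at h1
  unfold scaleType
  have h4 : ε * ρ ^ 2 ≤ ρ := by nlinarith [sq_nonneg ρ]
  nlinarith

/-- From log⁺(u²) = 2 log⁺ u ≤ 2u. The bound does not depend on S, so a truncation of Γ may be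
chosen after it. -/
theorem scaleLog_le (hS : ∀ γ ∈ S, 1 ≤ γ) (hsum : ∑ γ ∈ S, 1 / √(γ : ℝ) ≤ 1 / 2) {ρ : ℝ}
    (hρ : 0 < ρ) :
    scaleLog S m ε ρ ≤ 1 / ρ + m * Real.log (24 * (m + 1) / (ε * ρ ^ 2)) := by
  unfold scaleLog
  gcongr
  have h1 : ∑ γ ∈ S, posLog (1 / ((γ : ℝ) * ρ ^ 2)) ≤ ∑ γ ∈ S, 2 / ρ * (1 / √(γ : ℝ)) := by
    refine Finset.sum_le_sum fun γ hγ => ?_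
    have h0 : (0 : ℝ) < √(γ : ℝ) := Real.sqrt_pos.2 (by exact_mod_cast hS γ hγ)
    have h2 : 1 / ((γ : ℝ) * ρ ^ 2) = (1 / (ρ * √(γ : ℝ))) ^ 2 := by
      rw [div_pow, mul_pow, Real.sq_sqrt (Nat.cast_nonneg γ), one_pow, mul_comm]
    have h3 : 0 < 1 / (ρ * √(γ : ℝ)) := by positivity
    have h5 : 2 / ρ * (1 / √(γ : ℝ)) = 2 * (1 / (ρ * √(γ : ℝ))) := by field_simp
    rw [h2, h5, Real.posLog_pow]
    push_cast
    have h6 : posLog (1 / (ρ * √(γ : ℝ))) ≤ 1 / (ρ * √(γ : ℝ)) := by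
      rw [Real.posLog_def]
      exact max_le h3.le ((Real.log_le_sub_one_of_pos h3).trans (by linarith))
    gcongr
  rw [← Finset.mul_sum] at h1
  refine h1.trans ?_
  calc 2 / ρ * ∑ γ ∈ S, 1 / √(γ : ℝ) ≤ 2 / ρ * (1 / 2) := by gcongr
    _ = _ := by ring
end

/-! ### Truncation of Γ and the vanishing of the mean -/

theorem exists_finset_sum_le {Γ : Set ℕ}
    (hsum : Summable fun γ : Γ => 1 / √((γ : ℕ) : ℝ)) {e : ℝ} (he : 0 < e) :
    ∃ T : Finset ℕ, ∀ S : Finset ℕ, (S : Set ℕ) ⊆ Γ → ∑ γ ∈ S \ T, 1 / √(γ : ℝ) ≤ e := by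
  have h1 : Summable (Γ.indicator fun n : ℕ => 1 / √(n : ℝ)) :=
    (summable_subtype_iff_indicator (f := fun n : ℕ => 1 / √(n : ℝ))).1 hsum
  obtain ⟨T, hT⟩ := summable_iff_vanishing_norm.1 h1 e he
  refine ⟨T, fun S hS => ?_⟩
  have h2 := (hT (S \ T) Finset.sdiff_disjoint).le
  have h3 : ∑ γ ∈ S \ T, Γ.indicator (fun n : ℕ => 1 / √(n : ℝ)) γ = ∑ γ ∈ S \ T, 1 / √(γ : ℝ) :=
    Finset.sum_congr rfl fun γ hγ => indicator_of_mem (hS (Finset.mem_sdiff.1 hγ).1) _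
  rw [h3] at h2
  exact (le_abs_self _).trans h2

/-- Outside a disc of radius greater than one, the transforms belonging to the truncations of `Γ`
tend to zero. -/
theorem exists_norm_multTransform_le {Γ : Set ℕ} (hΓ : Γ ⊆ Ici 1) {T : Finset ℕ} {ε : ℝ}
    (hε : 0 < ε) (hε1 : ε ≤ 1)
    (hT : ∀ S : Finset ℕ, (S : Set ℕ) ⊆ Γ → ∑ γ ∈ S \ T, 1 / √(γ : ℝ) ≤ 1 / 2) {g : ℝ → ℂ}
    (hg : IntegrableOn g (Ioo 0 1))
    (hspec : ∀ n : ℕ, 1 ≤ n → n ∉ Γ → ∫ t in Ioo (0 : ℝ) 1, g t * circlePt t ^ n = 0)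
    {l δ : ℝ} (hl : 0 < l) (hδ : 0 < δ) :
    ∃ S : Finset ℕ, (S : Set ℕ) ⊆ Γ ∧ ∀ (b : ℕ → ℝ) (m : ℕ),
      (∀ x : ℂ, ∏ γ ∈ S, (1 + x / (γ : ℂ)) =
        ∑ k ∈ Finset.range (m + 1), (b k : ℂ) * risingBinom k x) →
      ∀ v : ℂ, 1 + l ≤ ‖v‖ → ‖multTransform b m g (Ioo 0 1) v‖ ≤ δ := by
  classical
  set q := 1 + l / 2 with hq
  have hq1 : 1 < q := by linarith
  set ϑ := q / (1 + l) with hϑ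
  have hϑ1 : ϑ < 1 := by
    rw [hϑ, div_lt_one (by linarith)]
    linarith
  have hϑ0 : 0 ≤ ϑ := by positivity
  -- At this scale the type is at most log q, so |P(-n)| ≤ C qⁿ with q < 1 + l. As C and q do not
  -- depend on S, the tail beyond N is small once N is large, and only then is S = Γ ∩ [1, N] fixed.
  set ρ := min 1 (Real.log q) with hρ
  have hρ0 : 0 < ρ := lt_min one_pos (Real.log_pos hq1)
  have hρ1 : ρ ≤ 1 := min_le_left _ _
  set C := Real.exp (1 / ρ + T.card * Real.log (24 * (T.card + 1) / (ε * ρ ^ 2))) with hC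
  have hlim : Filter.Tendsto (fun N : ℕ => C * (∫ t in Ioo (0 : ℝ) 1, ‖g t‖) * ϑ ^ N / (1 - ϑ))
      Filter.atTop (nhds 0) := by
    have := ((tendsto_pow_atTop_nhds_zero_of_lt_one hϑ0 hϑ1).const_mul
      (C * ∫ t in Ioo (0 : ℝ) 1, ‖g t‖)).div_const (1 - ϑ)
    simpa using this
  obtain ⟨N, hN⟩ := (hlim.eventually (gt_mem_nhds hδ)).exists
  set S := (Finset.Icc 1 N).filter (· ∈ Γ) with hS
  have hSΓ : (S : Set ℕ) ⊆ Γ := fun γ hγ => (Finset.mem_filter.1 (Finset.mem_coe.1 hγ)).2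
  refine ⟨S, hSΓ, fun b m hP v hv => ?_⟩
  have hS1 : ∀ γ ∈ S, 1 ≤ γ := fun γ hγ => hΓ (hSΓ hγ)
  have hST : ∀ γ ∈ S \ T, 1 ≤ γ := fun γ hγ => hS1 γ (Finset.mem_sdiff.1 hγ).1
  refine (norm_multTransform_le_of_one_lt (C := C) (q := q) (ϑ := ϑ) (N := N) hP hg
    (Real.exp_pos _).le (by linarith) hϑ1 (by linarith) ?_ ?_ ?_).trans hN.le
  · rw [hϑ, div_mul_eq_mul_div, le_div_iff₀ (by linarith)]
    gcongr
  · intro n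
    refine (norm_prod_one_add_div_le (T := T) hS1 hε hε1 hρ0 (by linarith) _).trans ?_
    have h1 : ‖-((n : ℂ) + 1)‖ = n + 1 := by
      rw [norm_neg]
      exact_mod_cast Complex.norm_natCast (n + 1)
    rw [h1, Real.exp_add]
    have h2 : Real.exp (scaleLog (S \ T) T.card ε ρ) ≤ C :=
      Real.exp_le_exp.2 (scaleLog_le hST (hT S hSΓ) hρ0)
    have h3 : scaleType (S \ T) ε ρ ≤ Real.log q :=
      (scaleType_le_self hST hε1 (hT S hSΓ) hρ0.le hρ1).trans (min_le_right _ _)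
    have h4 : Real.exp (scaleType (S \ T) ε ρ * (n + 1)) ≤ q ^ (n + 1) := by
      calc Real.exp (scaleType (S \ T) ε ρ * (n + 1)) ≤ Real.exp (Real.log q * (n + 1)) := by
            gcongr
        _ = q ^ (n + 1) := by
            rw [mul_comm, show ((n : ℝ) + 1) = ((n + 1 : ℕ) : ℝ) by push_cast; ring,
              Real.exp_nat_mul, Real.exp_log (by linarith)]
    exact mul_le_mul h2 h4 (Real.exp_pos _).le (Real.exp_pos _).le
  · intro n hn
    by_cases h : n + 1 ∈ Γ
    · left
      have hmem : n + 1 ∈ S := by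
        rw [hS, Finset.mem_filter, Finset.mem_Icc]
        exact ⟨⟨by omega, by omega⟩, h⟩
      refine Finset.prod_eq_zero hmem ?_
      have h0 : (n + 1 : ℂ) ≠ 0 := Nat.cast_add_one_ne_zero n
      push_cast
      rw [neg_div, div_self h0, add_neg_cancel]
    · right
      exact hspec (n + 1) (by omega) h

/-- If `g` is dominated by a monotone function with divergent logarithmic integral at the origin and
the positive frequencies of `g` lie in a set `Γ` with `∑ 1 / √γ < ∞`, then `g` has mean zero. -/
theorem integral_eq_zero_of_deep_zero {Γ : Set ℕ} (hΓ : Γ ⊆ Ici 1)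
    (hsum : Summable fun γ : Γ => 1 / √((γ : ℕ) : ℝ)) {g : ℝ → ℂ}
    (hg : IntegrableOn g (Ioo 0 1)) {η : ℝ → ℝ} (hη : ∀ t ∈ Ioo (0 : ℝ) 1, 0 < η t)
    (hmono : MonotoneOn η (Ioo 0 1)) (hbdd : ∃ W, ∀ t ∈ Ioo (0 : ℝ) 1, η t ≤ W) {q : ℝ → ℝ}
    (hq : IntegrableOn q (Ioo 0 1)) (hq0 : ∀ t, 0 ≤ q t)
    (hgq : ∀ᵐ t ∂volume.restrict (Ioo (0 : ℝ) 1), ‖g t‖ ≤ η t ^ 4 * q t)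
    (hlog : ∀ C : ℝ, ∃ τ ∈ Ioo (0 : ℝ) (1 / 4), ∫ t in τ..(1 / 4), Real.log (η (2 * t)) ≤ -C)
    (hspec : ∀ n : ℕ, 1 ≤ n → n ∉ Γ → ∫ t in Ioo (0 : ℝ) 1, g t * circlePt t ^ n = 0) :
    ∫ t in Ioo (0 : ℝ) 1, g t = 0 := by
  by_contra h0
  obtain ⟨W₀, hW₀⟩ := hbdd
  set W := max 1 W₀ with hWdef
  have hW : 1 ≤ W := le_max_left _ _
  set G := max 1 (max (∫ t in Ioo (0 : ℝ) 1, ‖g t‖) (∫ t in Ioo (0 : ℝ) 1, q t)) with hGdef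
  have hG : 1 ≤ G := le_max_left _ _
  have hGg : ∫ t in Ioo (0 : ℝ) 1, ‖g t‖ ≤ G := (le_max_left _ _).trans (le_max_right _ _)
  have hGq : ∫ t in Ioo (0 : ℝ) 1, q t ≤ G := (le_max_right _ _).trans (le_max_right _ _)
  -- The tail bound 1/9600 below gives 48/9600 = 1/200, so the total displacement constant is 1/100.
  set ε : ℝ := 1 / 200 with hεdef
  have hε : 0 < ε := by norm_num [hεdef]
  have hε1 : ε ≤ 1 := by norm_num [hεdef]
  obtain ⟨T, hT⟩ := exists_finset_sum_le hsum (e := 1 / 9600) (by norm_num)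
  set a := 24 * G * W ^ 3 with ha
  have ha1 : 1 ≤ a := by
    have h1 : 1 ≤ W ^ 3 := one_le_pow₀ hW
    nlinarith
  have ha0 : 0 < a := by linarith
  -- A bound for the integral of M(t) + M(1 - t) that involves neither S nor τ. Hence τ can be
  -- chosen from it, and S from τ.
  set C₀ := 2 * (2 * (1 / 9600) +
    (T.card * (Real.log (24 * (T.card + 1) / ε) + 2) + (Real.log (a / ε) + 2))) with hC₀
  obtain ⟨τ, ⟨hτ0, hτ1⟩, hτ⟩ := hlog (C₀ - Real.log ‖∫ t in Ioo (0 : ℝ) 1, g t‖ + 1)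
  have hητ : 0 < η (2 * τ) := hη _ ⟨by linarith, by linarith⟩
  -- For every t > τ used below, ρ/25 ≥ τ/25 and η(2τ) ≤ η(2t), so this single choice serves all t
  -- in (τ, 1/4).
  obtain ⟨S, hSΓ, hout⟩ := exists_norm_multTransform_le (T := T) hΓ hε hε1
    (fun S hS => (hT S hS).trans (by norm_num)) hg hspec (l := τ / 25) (δ := η (2 * τ) ^ 4)
    (by positivity) (by positivity)
  have hS1 : ∀ γ ∈ S, 1 ≤ γ := fun γ hγ => hΓ (hSΓ hγ)
  have hST : ∀ γ ∈ S \ T, 1 ≤ γ := fun γ hγ => hS1 γ (Finset.mem_sdiff.1 hγ).1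
  obtain ⟨b, hb, -, hP⟩ := exists_coeff_risingBinom S hS1
  set m := S.card with hm
  have hκ : ε + 48 * ∑ γ ∈ S \ T, 1 / √(γ : ℝ) ≤ 1 / 100 := by
    have := hT S hSΓ
    rw [hεdef]
    linarith
  -- Then 100(1 - r) = τ ≤ ρ on the arc (τ, 1/4), as `norm_multTransform_pushMap_le_of_small`
  -- requires.
  set r := 1 - τ / 100 with hr
  have hr0 : 0 < r := by linarith
  have hr1 : r < 1 := by linarith
  set F := multTransform b m g (Ioo 0 1) with hF
  have hznorm : ∀ t, ‖(r : ℂ) * circlePt t‖ = r := fun t => by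
    rw [norm_mul, norm_circlePt, Complex.norm_real, Real.norm_of_nonneg hr0.le, mul_one]
  set M := logMajorant (S \ T) T.card ε a with hM
  set L : ℝ → ℝ := (Ioo τ (1 / 4)).indicator fun t => Real.log (η (2 * t)) with hL
  have hMint := integral_logMajorant (m := T.card) hST hε ha0
  have hMint' : IntervalIntegrable (fun t => M (1 - t)) volume 0 1 := by
    have := (hMint.1.comp_sub_left 1).symm
    simpa using this
  have hLmono : MonotoneOn (fun t => Real.log (η (2 * t))) (Icc τ (1 / 4)) := by
    intro x hx y hy hxy
    have hx' : 2 * x ∈ Ioo (0 : ℝ) 1 := ⟨by linarith [hx.1], by linarith [hx.2]⟩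
    have hy' : 2 * y ∈ Ioo (0 : ℝ) 1 := ⟨by linarith [hy.1], by linarith [hy.2]⟩
    exact Real.log_le_log (hη _ hx') (hmono hx' hy' (by linarith))
  have hLint : IntegrableOn (fun t => Real.log (η (2 * t))) (Ioo τ (1 / 4)) :=
    (hLmono.integrableOn_isCompact isCompact_Icc).mono_set Ioo_subset_Icc_self
  have hLint' : IntervalIntegrable L volume 0 1 := by
    rw [intervalIntegrable_iff_integrableOn_Ioo_of_le zero_le_one]
    exact ((integrable_indicator_iff measurableSet_Ioo).2 hLint).integrableOn
  have hLval : ∫ t in (0 : ℝ)..1, L t = ∫ t in τ..(1 / 4), Real.log (η (2 * t)) := by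
    rw [intervalIntegral.integral_of_le zero_le_one, intervalIntegral.integral_of_le hτ1.le,
      integral_Ioc_eq_integral_Ioo, integral_Ioc_eq_integral_Ioo, hL,
      setIntegral_indicator measurableSet_Ioo, inter_eq_right.2]
    exact Ioo_subset_Ioo hτ0.le (by norm_num)
  have hFd : DifferentiableOn ℂ (fun z => F (pushMap (S \ T) ε z)) (Metric.ball 0 1) := by
    refine (differentiableOn_multTransform b m measurableSet_Ioo hg).comp
      (differentiableOn_pushMap hST) fun z hz => ?_
    rw [mem_ball_zero_iff] at hz ⊢
    have h1 := norm_pushMap_le hST hε hκ hz.le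
    have hρ : 0 < ‖1 - z‖ := by
      refine norm_pos_iff.2 fun h => ?_
      rw [← sub_eq_zero.1 h, norm_one] at hz
      exact lt_irrefl _ hz
    have := scaleType_pos (S := S \ T) hε hρ
    linarith
  have hF0 : F (pushMap (S \ T) ε 0) = ∫ t in Ioo (0 : ℝ) 1, g t := by
    rw [pushMap_zero, hF, multTransform_zero_right]
    rw [← hP]
    simp
  have hjensen := log_norm_le_integral_of_le hr0 hr1 hFd (by rwa [hF0])
    (V := fun t => M t + M (1 - t) + L t) ((hMint.1.add hMint').add hLint') ?_
  · rw [hF0, intervalIntegral.integral_add (hMint.1.add hMint') hLint',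
      intervalIntegral.integral_add hMint.1 hMint', hLval,
      intervalIntegral.integral_comp_sub_left (fun t => M t) 1] at hjensen
    simp only [sub_self, sub_zero] at hjensen
    rw [hMint.2] at hjensen
    have h1 := hT S hSΓ
    linarith
  · intro t ht hne
    set ρ := ‖1 - r * circlePt t‖ with hρ
    have hmin : min t (1 - t) ≤ ρ := min_le_norm_one_sub ht hr0.le hr1.le
    have hmin0 : 0 < min t (1 - t) := lt_min ht.1 (by linarith [ht.2])
    have hρ0 : 0 < ρ := hmin0.trans_le hmin
    -- M decreases and is nonnegative on (0, 1], so its value at min(t, 1 - t) is covered by the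
    -- sum; this avoids integrating a minimum.
    have hMρ : M ρ ≤ M t + M (1 - t) := by
      have h1 := logMajorant_anti (m := T.card) hST hε ha0 hmin0 hmin
      have h2 : 0 ≤ M t := logMajorant_nonneg hε hε1 ha1 ht.1 ht.2.le
      have h3 : 0 ≤ M (1 - t) :=
        logMajorant_nonneg hε hε1 ha1 (by linarith [ht.2]) (by linarith [ht.1])
      rcases min_choice t (1 - t) with h | h <;> rw [h] at h1 <;> linarith
    have hzt : ‖(r : ℂ) * circlePt t‖ < 1 := by
      rw [hznorm]
      exact hr1
    have hpos : 0 < ‖F (pushMap (S \ T) ε (r * circlePt t))‖ := norm_pos_iff.2 hne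
    have hlogM : M ρ = Real.log
        (a / (ε * ρ ^ 2) * Real.exp (scaleLog (S \ T) T.card ε ρ)) := by
      rw [Real.log_mul (by positivity) (Real.exp_pos _).ne', Real.log_exp, add_comm]
      rfl
    by_cases hts : t ∈ Ioo τ (1 / 4)
    · have ht2 : 2 * t ∈ Ioo (0 : ℝ) 1 := ⟨by linarith [ht.1], by linarith [hts.2]⟩
      have hLt : L t = Real.log (η (2 * t)) := indicator_of_mem hts _
      have hρτ : τ ≤ ρ := by
        refine le_trans (le_min hts.1.le ?_) hmin
        linarith [hts.2]
      have hττ : 2 * τ ∈ Ioo (0 : ℝ) 1 := ⟨by linarith, by linarith⟩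
      have hsmall : ∫ s in Ioo 0 (2 * t), ‖g s‖ ≤ G * η (2 * t) ^ 4 := by
        have hsub : Ioo 0 (2 * t) ⊆ Ioo (0 : ℝ) 1 := Ioo_subset_Ioo_right ht2.2.le
        have h1 : ∫ s in Ioo 0 (2 * t), ‖g s‖ ≤ ∫ s in Ioo 0 (2 * t), η (2 * t) ^ 4 * q s := by
          refine setIntegral_mono_ae_restrict (hg.mono_set hsub).norm
            ((hq.mono_set hsub).const_mul _) ?_
          filter_upwards [ae_restrict_mem measurableSet_Ioo,
            ae_mono (Measure.restrict_mono hsub le_rfl) hgq] with s hs hs'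
          refine hs'.trans (mul_le_mul_of_nonneg_right ?_ (hq0 s))
          exact pow_le_pow_left₀ (hη s (hsub hs)).le (hmono (hsub hs) ht2 hs.2.le) 4
        rw [integral_const_mul] at h1
        have h2 : ∫ s in Ioo 0 (2 * t), q s ≤ G :=
          (setIntegral_mono_set hq (Filter.Eventually.of_forall hq0) hsub.eventuallyLE).trans hGq
        have h3 : 0 ≤ η (2 * t) ^ 4 := by positivity
        nlinarith
      have hest := norm_multTransform_pushMap_le_of_small (T := T) hS1 hε hκ hε1 hb hP hg hr0.le hr1
        ht.1 hts.2.le (by rw [← hρ]; linarith) hG hW (hη _ ht2).le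
        ((hW₀ _ ht2).trans (le_max_right _ _)) hGg hsmall (fun v hv => by
          refine (hout b m hP v (by linarith)).trans ?_
          exact pow_le_pow_left₀ hητ.le (hmono hττ ht2 (by linarith [hts.1])) 4)
      rw [← hρ, ← ha] at hest
      have h4 := Real.log_le_log hpos hest
      rw [Real.log_mul (by positivity) (hη _ ht2).ne', ← hlogM] at h4
      rw [hLt]
      linarith
    · have hLt : L t = 0 := indicator_of_notMem hts _
      have hest := norm_multTransform_pushMap_le (T := T) hS1 hε hκ hε1 hb hP measurableSet_Ioo hg
        hzt
      rw [← hρ] at hest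
      have hest' : ‖F (pushMap (S \ T) ε (r * circlePt t))‖ ≤
          a / (ε * ρ ^ 2) * Real.exp (scaleLog (S \ T) T.card ε ρ) := by
        refine hest.trans ?_
        have h1 : 8 * G ≤ a := by
          have h1 : 1 ≤ W ^ 3 := one_le_pow₀ hW
          nlinarith
        calc _ ≤ 8 * Real.exp (scaleLog (S \ T) T.card ε ρ) / (ε * ρ ^ 2) * G := by gcongr
          _ = 8 * G / (ε * ρ ^ 2) * Real.exp (scaleLog (S \ T) T.card ε ρ) := by ring
          _ ≤ _ := by gcongr
      have h4 := Real.log_le_log hpos hest'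
      rw [← hlogM] at h4
      rw [hLt]
      linarith

/-! ### From the mean to all Fourier coefficients -/

theorem summable_one_div_sqrt_image_add {Γ : Set ℕ} (hΓ : Γ ⊆ Ici 1)
    (hsum : Summable fun γ : Γ => 1 / √((γ : ℕ) : ℝ)) (n : ℕ) :
    Summable fun γ : ((fun γ : ℕ => γ + n) '' Γ : Set ℕ) => 1 / √((γ : ℕ) : ℝ) := by
  rw [← (Equiv.Set.image (fun γ : ℕ => γ + n) Γ (add_left_injective n)).summable_iff]
  refine Summable.of_nonneg_of_le (fun γ => one_div_nonneg.2 (Real.sqrt_nonneg _)) (fun γ => ?_) hsum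
  have h1 : (1 : ℝ) ≤ (γ : ℕ) := by exact_mod_cast hΓ γ.2
  simp only [Function.comp_apply, Equiv.Set.image_apply]
  refine one_div_le_one_div_of_le (Real.sqrt_pos.2 (by linarith)) (Real.sqrt_le_sqrt ?_)
  push_cast
  have : (0 : ℝ) ≤ n := Nat.cast_nonneg n
  linarith

/-- Multiplying g by e^{-2πint} keeps |g| and turns the k-th moment into the one of index k - n. For
k ≤ n it vanishes by strong induction; for k > n it vanishes off Γ + n, which is as sparse as Γ. -/
theorem integral_mul_inv_pow_eq_zero {Γ : Set ℕ} (hΓ : Γ ⊆ Ici 1)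
    (hsum : Summable fun γ : Γ => 1 / √((γ : ℕ) : ℝ)) {g : ℝ → ℂ}
    (hg : IntegrableOn g (Ioo 0 1)) {η : ℝ → ℝ} (hη : ∀ t ∈ Ioo (0 : ℝ) 1, 0 < η t)
    (hmono : MonotoneOn η (Ioo 0 1)) (hbdd : ∃ W, ∀ t ∈ Ioo (0 : ℝ) 1, η t ≤ W) {q : ℝ → ℝ}
    (hq : IntegrableOn q (Ioo 0 1)) (hq0 : ∀ t, 0 ≤ q t)
    (hgq : ∀ᵐ t ∂volume.restrict (Ioo (0 : ℝ) 1), ‖g t‖ ≤ η t ^ 4 * q t)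
    (hlog : ∀ C : ℝ, ∃ τ ∈ Ioo (0 : ℝ) (1 / 4), ∫ t in τ..(1 / 4), Real.log (η (2 * t)) ≤ -C)
    (hspec : ∀ n : ℕ, 1 ≤ n → n ∉ Γ → ∫ t in Ioo (0 : ℝ) 1, g t * circlePt t ^ n = 0) (n : ℕ) :
    ∫ t in Ioo (0 : ℝ) 1, g t * (circlePt t)⁻¹ ^ n = 0 := by
  induction n using Nat.strong_induction_on with
  | _ n ih =>
    have hunit : ∀ t, ‖(circlePt t)⁻¹ ^ n‖ = 1 := fun t => by
      rw [norm_pow, norm_inv, norm_circlePt, inv_one, one_pow]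
    have hcont : Continuous fun t => (circlePt t)⁻¹ ^ n :=
      (continuous_circlePt.inv₀ circlePt_ne_zero).pow n
    refine integral_eq_zero_of_deep_zero (Γ := (fun γ => γ + n) '' Γ) ?_
      (summable_one_div_sqrt_image_add hΓ hsum n)
      (Integrable.mul_bdd (c := 1) hg hcont.aestronglyMeasurable
        (Filter.Eventually.of_forall fun t => (hunit t).le)) hη hmono hbdd hq hq0 ?_ hlog ?_
    · rintro _ ⟨γ, hγ, rfl⟩
      exact le_trans (hΓ hγ) (Nat.le_add_right γ n)
    · filter_upwards [hgq] with t ht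
      rwa [norm_mul, hunit, mul_one]
    · intro k hk hkΓ
      rcases le_or_gt k n with h | h
      · rw [← ih (n - k) (by omega)]
        congr 1
        funext t
        have h1 : (circlePt t)⁻¹ ^ n = (circlePt t)⁻¹ ^ (n - k) * (circlePt t)⁻¹ ^ k := by
          rw [← pow_add, Nat.sub_add_cancel h]
        rw [h1, mul_assoc, mul_assoc, ← mul_pow, inv_mul_cancel₀ (circlePt_ne_zero t), one_pow,
          mul_one]
      · rw [← hspec (k - n) (by omega) fun hmem => hkΓ ⟨k - n, hmem, by
          show k - n + n = k
          omega⟩]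
        congr 1
        funext t
        have h1 : circlePt t ^ k = circlePt t ^ n * circlePt t ^ (k - n) := by
          rw [← pow_add, Nat.add_sub_cancel' h.le]
        rw [h1, mul_assoc, ← mul_assoc ((circlePt t)⁻¹ ^ n), ← mul_pow,
          inv_mul_cancel₀ (circlePt_ne_zero t), one_pow, one_mul]

theorem ae_eq_zero_of_forall_integral_eq_zero {g : ℝ → ℂ}
    (hg : MemLp g 2 (volume.restrict (Ioo 0 1)))
    (hpos : ∀ n : ℕ, ∫ t in Ioo (0 : ℝ) 1, g t * circlePt t ^ n = 0)
    (hneg : ∀ n : ℕ, ∫ t in Ioo (0 : ℝ) 1, g t * (circlePt t)⁻¹ ^ n = 0) :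
    g =ᵐ[volume.restrict (Ioo 0 1)] 0 := by
  have hg' : MemLp g 2 (volume.restrict (Ioc 0 1)) := by
    rwa [← Measure.restrict_congr_set Ioo_ae_eq_Ioc]
  have hall : ∀ n : ℤ, ∫ t in Ioo (0 : ℝ) 1, g t * circlePt t ^ n = 0 := by
    intro n
    rcases Int.eq_nat_or_neg n with ⟨k, rfl | rfl⟩
    · simpa using hpos k
    · simpa using hneg k
  have hcoef : ∀ n : ℤ, fourierCoeffOn zero_lt_one g n = 0 := by
    intro n
    rw [fourierCoeffOn_eq_integral, intervalIntegral.integral_of_le zero_le_one,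
      integral_Ioc_eq_integral_Ioo]
    have h1 : ∀ t : ℝ, fourier (-n) (t : AddCircle ((1 : ℝ) - 0)) • g t =
        g t * circlePt t ^ (-n) := by
      intro t
      rw [fourier_coe_apply, smul_eq_mul, mul_comm, circlePt, ← Complex.exp_int_mul]
      congr 2
      push_cast
      ring
    simp only [h1, hall, smul_zero]
  have h := hasSum_sq_fourierCoeffOn zero_lt_one hg'
  simp only [hcoef, norm_zero, ne_eq, OfNat.ofNat_ne_zero, not_false_eq_true, zero_pow, sub_zero,
    inv_one, one_smul] at h
  have h0 := h.unique hasSum_zero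
  rw [intervalIntegral.integral_of_le zero_le_one, integral_Ioc_eq_integral_Ioo] at h0
  have h2 : Integrable (fun t => ‖g t‖ ^ 2) (volume.restrict (Ioo 0 1)) :=
    (memLp_two_iff_integrable_sq_norm hg.1).1 hg
  have h3 := (integral_eq_zero_iff_of_nonneg (fun t => by positivity) h2).1 h0
  filter_upwards [h3] with t ht
  simpa using ht

/-! ### The weight and the conclusion -/

/-- Otherwise the integrals of log⁻ w over (2τ, 1/2) are uniformly bounded, hence by monotone
convergence so is the one over (0, 1/2). On [1/2, 1) monotonicity bounds log w below by log w(1/2),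
so the total would be finite. -/
theorem IsDeepZeroWeight.exists_integral_log_le {w : ℝ → ℝ} (hw : IsDeepZeroWeight w) (C : ℝ) :
    ∃ τ ∈ Ioo (0 : ℝ) (1 / 4), ∫ t in τ..(1 / 4), Real.log (√√√(w (2 * t))) ≤ -C := by
  by_contra! hcon
  obtain ⟨M, hM⟩ := hw.bdd
  have hlogmono : MonotoneOn (fun t => Real.log (w t)) (Ioo 0 1) := fun x hx y hy hxy =>
    Real.log_le_log (hw.pos x hx) (hw.mono hx hy hxy)
  set K := |Real.log M| with hK
  have hlogK : ∀ t ∈ Ioo (0 : ℝ) 1, Real.log (w t) ≤ K := fun t ht =>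
    (Real.log_le_log (hw.pos t ht) (hM t ht)).trans (le_abs_self _)
  have hK0 : 0 ≤ K := abs_nonneg _
  have hbound : ∀ τ ∈ Ioo (0 : ℝ) (1 / 4),
      ∫⁻ t in Ioo (2 * τ) (1 / 2), ENNReal.ofReal (-Real.log (w t)) ≤
        ENNReal.ofReal (16 * C + 2 * K) := by
    intro τ hτ
    have h1 := hcon τ hτ
    have hsub : Icc (2 * τ) (1 / 2) ⊆ Ioo (0 : ℝ) 1 := fun t ht =>
      ⟨by linarith [hτ.1, ht.1], by linarith [ht.2]⟩
    have hint : IntegrableOn (fun t => Real.log (w t)) (Ioo (2 * τ) (1 / 2)) :=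
      ((hlogmono.mono hsub).integrableOn_isCompact isCompact_Icc).mono_set Ioo_subset_Icc_self
    -- The factor 1/16 is 1/8 from the three square roots times 1/2 from the substitution.
    have h2 : ∫ t in τ..(1 / 4), Real.log (√√√(w (2 * t))) =
        (1 / 16) * ∫ t in Ioo (2 * τ) (1 / 2), Real.log (w t) := by
      have h3 : ∀ t ∈ uIcc τ (1 / 4), Real.log (√√√(w (2 * t))) =
          (1 / 8) * Real.log (w (2 * t)) := by
        intro t ht
        rw [uIcc_of_le hτ.2.le] at ht
        have hp := hw.pos (2 * t) ⟨by linarith [hτ.1, ht.1], by linarith [ht.2]⟩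
        rw [Real.log_sqrt (by positivity), Real.log_sqrt (by positivity), Real.log_sqrt hp.le]
        ring
      rw [intervalIntegral.integral_congr h3, intervalIntegral.integral_const_mul,
        intervalIntegral.integral_comp_mul_left (fun t => Real.log (w t)) two_ne_zero,
        intervalIntegral.integral_of_le (by linarith [hτ.2]), integral_Ioc_eq_integral_Ioo,
        show (2 : ℝ) * (1 / 4) = 1 / 2 by norm_num, smul_eq_mul]
      ring
    rw [h2] at h1
    have hKint : IntegrableOn (fun t => K - Real.log (w t)) (Ioo (2 * τ) (1 / 2)) :=
      (integrable_const K).sub hint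
    calc ∫⁻ t in Ioo (2 * τ) (1 / 2), ENNReal.ofReal (-Real.log (w t))
        ≤ ∫⁻ t in Ioo (2 * τ) (1 / 2), ENNReal.ofReal (K - Real.log (w t)) :=
          lintegral_mono fun t => ENNReal.ofReal_le_ofReal (by linarith)
      _ = ENNReal.ofReal (∫ t in Ioo (2 * τ) (1 / 2), (K - Real.log (w t))) := by
          rw [ofReal_integral_eq_lintegral_ofReal hKint]
          filter_upwards [ae_restrict_mem measurableSet_Ioo] with t ht
          have := hlogK t (hsub (Ioo_subset_Icc_self ht))
          simpa using this
      _ ≤ _ := by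
          refine ENNReal.ofReal_le_ofReal ?_
          rw [integral_sub (integrable_const K) hint, setIntegral_const]
          have h4 : volume.real (Ioo (2 * τ) (1 / 2)) ≤ 1 := by
            rw [Real.volume_real_Ioo_of_le (by linarith [hτ.2])]
            linarith [hτ.1]
          rw [smul_eq_mul]
          nlinarith
  have hhalf : ∫⁻ t in Ioo (0 : ℝ) (1 / 2), ENNReal.ofReal (-Real.log (w t)) ≤
      ENNReal.ofReal (16 * C + 2 * K) := by
    have hU : Ioo (0 : ℝ) (1 / 2) = ⋃ n : ℕ, Ioo (2 * (1 / ((n : ℝ) + 5))) (1 / 2) := by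
      ext t
      simp only [mem_iUnion, mem_Ioo]
      constructor
      · rintro ⟨h1, h2⟩
        obtain ⟨n, hn⟩ := exists_nat_one_div_lt (half_pos h1)
        refine ⟨n, ?_, h2⟩
        have : 1 / ((n : ℝ) + 5) ≤ 1 / ((n : ℝ) + 1) := by gcongr; norm_num
        linarith
      · rintro ⟨n, h1, h2⟩
        exact ⟨lt_trans (by positivity) h1, h2⟩
    rw [hU, setLIntegral_iUnion_of_directed]
    · refine iSup_le fun n => hbound _ ⟨by positivity, ?_⟩
      gcongr
      have : (0 : ℝ) ≤ n := Nat.cast_nonneg n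
      linarith
    · refine Monotone.directed_le fun m n hmn => Ioo_subset_Ioo_left ?_
      have : (m : ℝ) ≤ n := by exact_mod_cast hmn
      gcongr
  have hrest : ∫⁻ t in Ico (1 / 2 : ℝ) 1, ENNReal.ofReal (-Real.log (w t)) < ∞ := by
    calc ∫⁻ t in Ico (1 / 2 : ℝ) 1, ENNReal.ofReal (-Real.log (w t))
        ≤ ∫⁻ _ in Ico (1 / 2 : ℝ) 1, ENNReal.ofReal (-Real.log (w (1 / 2))) :=
          setLIntegral_mono measurable_const fun t ht => ENNReal.ofReal_le_ofReal
            (neg_le_neg (hlogmono (by norm_num) ⟨by linarith [ht.1], ht.2⟩ ht.1))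
      _ < ∞ := by
          rw [setLIntegral_const]
          exact ENNReal.mul_lt_top ENNReal.ofReal_lt_top (by simp)
  have htot := hw.log_int.2
  rw [← Ioo_union_Ico_eq_Ioo (by norm_num : (0 : ℝ) < 1 / 2) (by norm_num : (1 / 2 : ℝ) ≤ 1)] at htot
  have hle := lintegral_union_le (μ := volume) (fun t => ENNReal.ofReal (-Real.log (w t)))
    (Ioo (0 : ℝ) (1 / 2)) (Ico (1 / 2) 1)
  rw [htot] at hle
  exact absurd (top_le_iff.1 hle)
    (ENNReal.add_lt_top.2 ⟨hhalf.trans_lt ENNReal.ofReal_lt_top, hrest⟩).ne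

theorem expo_eq_circlePt_pow (n : ℕ) (t : ℝ) : expo n t = circlePt t ^ n := by
  rw [expo, circlePt, ← Complex.exp_nat_mul]
  congr 1
  ring

theorem IsDeepZeroWeight.expSystemSpans {Γ : Set ℕ} (hΓ : Γ ⊆ Ici 1)
    (hsum : Summable fun γ : Γ => 1 / √((γ : ℕ) : ℝ)) {w : ℝ → ℝ} (hw : IsDeepZeroWeight w) :
    ExpSystemSpans w (Ici 1 \ Γ) := by
  unfold ExpSystemSpans
  rw [Submodule.topologicalClosure_eq_top_iff, Submodule.eq_bot_iff]
  intro f hf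
  set ν := volume.restrict (Ioo (0 : ℝ) 1) with hν
  have hwm : AEMeasurable w ν := aemeasurable_restrict_of_monotoneOn measurableSet_Ioo hw.mono
  have hdm : AEMeasurable (fun t => ENNReal.ofReal (w t)) ν := hwm.ennreal_ofReal
  have hwpos : ∀ᵐ t ∂ν, 0 < w t := by
    filter_upwards [ae_restrict_mem measurableSet_Ioo] with t ht using hw.pos t ht
  have hac : ν ≪ weightMeasure w := by
    refine withDensity_absolutelyContinuous' hdm ?_
    filter_upwards [hwpos] with t ht
    simpa using ht
  have hac' : weightMeasure w ≪ ν := withDensity_absolutelyContinuous _ _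
  have hfm : AEStronglyMeasurable f ν := (Lp.aestronglyMeasurable f).mono_ac hac
  have hf2 : Integrable (fun t => ‖f t‖ ^ 2) (weightMeasure w) :=
    (memLp_two_iff_integrable_sq_norm (Lp.aestronglyMeasurable f)).1 (Lp.memLp f)
  have hf2' : Integrable (fun t => w t * ‖f t‖ ^ 2) ν := by
    have h1 := (integrable_withDensity_iff_integrable_smul₀' hdm
      (Filter.Eventually.of_forall fun t => ENNReal.ofReal_lt_top)).1 hf2
    refine h1.congr ?_
    filter_upwards [hwpos] with t ht
    rw [ENNReal.toReal_ofReal ht.le, smul_eq_mul]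
  have hswm : AEStronglyMeasurable (fun t => √(w t)) ν :=
    (Real.continuous_sqrt.measurable.comp_aemeasurable hwm).aestronglyMeasurable
  have hqL2 : MemLp (fun t => ‖f t‖ * √(w t)) 2 ν := by
    refine (memLp_two_iff_integrable_sq (hfm.norm.mul hswm)).2 (hf2'.congr ?_)
    filter_upwards [hwpos] with t ht
    show _ = (‖f t‖ * √(w t)) ^ 2
    rw [mul_pow, Real.sq_sqrt ht.le, mul_comm]
  have hq : IntegrableOn (fun t => ‖f t‖ * √(w t)) (Ioo 0 1) := hqL2.integrable (by norm_num)
  set g : ℝ → ℂ := fun t => w t * conj (f t) with hgdef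
  -- The choice η = w^{1/8} gives η⁴ = √w, which splits |g| = w|f| into η⁴ and q = |f|√w, a function
  -- in L².
  have hgnorm : ∀ᵐ t ∂ν, ‖g t‖ = √√√(w t) ^ 4 * (‖f t‖ * √(w t)) := by
    filter_upwards [hwpos] with t ht
    rw [hgdef]
    simp only [norm_mul, Complex.norm_real, RCLike.norm_conj, Real.norm_of_nonneg ht.le]
    have h1 : √√√(w t) ^ 4 = √(w t) := by
      rw [show 4 = 2 * 2 by norm_num, pow_mul, Real.sq_sqrt (by positivity),
        Real.sq_sqrt (by positivity)]
    have h2 : √(w t) * √(w t) = w t := Real.mul_self_sqrt ht.le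
    rw [h1]
    linear_combination -‖f t‖ * h2
  have hgm : AEStronglyMeasurable g ν :=
    (Complex.continuous_ofReal.comp_aestronglyMeasurable hwm.aestronglyMeasurable).mul
      (Complex.continuous_conj.comp_aestronglyMeasurable hfm)
  have hη : ∀ t ∈ Ioo (0 : ℝ) 1, 0 < √√√(w t) := fun t ht =>
    Real.sqrt_pos.2 (Real.sqrt_pos.2 (Real.sqrt_pos.2 (hw.pos t ht)))
  have hmono : MonotoneOn (fun t => √√√(w t)) (Ioo 0 1) := fun x hx y hy hxy =>
    Real.sqrt_le_sqrt (Real.sqrt_le_sqrt (Real.sqrt_le_sqrt (hw.mono hx hy hxy)))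
  obtain ⟨M, hM⟩ := hw.bdd
  have hbd : ∀ t ∈ Ioo (0 : ℝ) 1, √√√(w t) ≤ √√√M := fun t ht =>
    Real.sqrt_le_sqrt (Real.sqrt_le_sqrt (Real.sqrt_le_sqrt (hM t ht)))
  have hgL2 : MemLp g 2 ν := by
    refine hqL2.of_le_mul (c := √√√M ^ 4) hgm ?_
    filter_upwards [hgnorm, ae_restrict_mem measurableSet_Ioo] with t ht ht'
    rw [ht, Real.norm_of_nonneg (by positivity : 0 ≤ ‖f t‖ * √(w t))]
    have := hbd t ht'
    gcongr
  have hg : IntegrableOn g (Ioo 0 1) := hgL2.integrable (by norm_num)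
  have hspec : ∀ n : ℕ, 1 ≤ n → n ∉ Γ → ∫ t in Ioo (0 : ℝ) 1, g t * circlePt t ^ n = 0 := by
    intro n hn hnΓ
    have hmem : (hw.memLp_expo n).toLp (expo n) ∈ expSystem w (Ici 1 \ Γ) :=
      ⟨n, ⟨hn, hnΓ⟩, MemLp.coeFn_toLp _⟩
    have h1 := (Submodule.mem_orthogonal' _ f).1 hf _ (Submodule.subset_span hmem)
    rw [L2.inner_def] at h1
    have h2 : ∫ t, expo n t * conj (f t) ∂(weightMeasure w) = 0 := by
      rw [← h1]
      refine integral_congr_ae ?_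
      filter_upwards [(hw.memLp_expo n).coeFn_toLp] with t ht
      rw [ht, RCLike.inner_apply]
    have h3 := integral_withDensity_eq_integral_toReal_smul₀ hdm
      (Filter.Eventually.of_forall fun t => ENNReal.ofReal_lt_top)
      (fun t => expo n t * conj (f t))
    rw [← h2]
    refine Eq.trans (integral_congr_ae ?_) h3.symm
    filter_upwards [hwpos] with t ht
    rw [ENNReal.toReal_ofReal ht.le, hgdef, expo_eq_circlePt_pow, Complex.real_smul]
    ring
  have hgq : ∀ᵐ t ∂ν, ‖g t‖ ≤ √√√(w t) ^ 4 * (‖f t‖ * √(w t)) := hgnorm.mono fun t ht => ht.le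
  have hq0 : ∀ t, 0 ≤ ‖f t‖ * √(w t) := fun t => by positivity
  have hneg := integral_mul_inv_pow_eq_zero hΓ hsum hg hη hmono ⟨_, hbd⟩ hq hq0 hgq
    hw.exists_integral_log_le hspec
  have hconj : ∀ (n : ℕ) (t : ℝ), conj (g t * (circlePt t)⁻¹ ^ n) = conj (g t) * circlePt t ^ n := by
    intro n t
    rw [map_mul, map_pow, Complex.inv_eq_conj (norm_circlePt t), Complex.conj_conj]
  -- The moments of g of index ≤ 0 are now known to vanish, so conj g has no exceptional
  -- frequencies: the same result with Γ empty gives the moments of g of index ≥ 0, including those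
  -- in Γ.
  have hneg' := integral_mul_inv_pow_eq_zero (Γ := ∅) (g := fun t => conj (g t)) (empty_subset _)
    Summable.of_finite
    (Complex.conjLIE.integrable_comp_iff.2 hg) hη hmono ⟨_, hbd⟩ hq hq0
    (hgq.mono fun t ht => by rwa [RCLike.norm_conj]) hw.exists_integral_log_le fun n _ _ => by
      simp only [← hconj]
      rw [integral_conj, hneg n, map_zero]
  have hpos : ∀ n : ℕ, ∫ t in Ioo (0 : ℝ) 1, g t * circlePt t ^ n = 0 := by
    intro n
    have h1 : ∀ t, conj (g t) * (circlePt t)⁻¹ ^ n = conj (g t * circlePt t ^ n) := by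
      intro t
      rw [map_mul _ (g t), map_pow, Complex.inv_eq_conj (norm_circlePt t)]
    have h2 := hneg' n
    simp only [h1] at h2
    rw [integral_conj] at h2
    simpa using h2
  have hg0 := ae_eq_zero_of_forall_integral_eq_zero hgL2 hpos hneg
  refine (Lp.eq_zero_iff_ae_eq_zero).2 (hac'.ae_le ?_)
  filter_upwards [hg0, hwpos] with t ht hwt
  have h1 : (w t : ℂ) ≠ 0 := by exact_mod_cast hwt.ne'
  simpa [hgdef, h1] using ht

theorem summable_one_div_sqrt_cubes :
    Summable fun γ : {m : ℕ | ∃ k : ℕ, 1 ≤ k ∧ m = k ^ 3} => 1 / √((γ : ℕ) : ℝ) := by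
  have hinj : Function.Injective fun k : ℕ => k ^ 3 := fun a b h =>
    Nat.pow_left_injective (by norm_num) h
  have himg : {m : ℕ | ∃ k : ℕ, 1 ≤ k ∧ m = k ^ 3} = (fun k : ℕ => k ^ 3) '' Ici 1 := by
    ext m
    simp [eq_comm]
  rw [himg, ← (Equiv.Set.image (fun k : ℕ => k ^ 3) (Ici 1) hinj).summable_iff]
  have h1 : Summable fun k : ℕ => 1 / (k : ℝ) ^ (3 / 2 : ℝ) :=
    Real.summable_one_div_nat_rpow.2 (by norm_num)
  refine (h1.subtype (Ici 1)).congr fun k => ?_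
  simp only [Function.comp_apply, Equiv.Set.image_apply]
  push_cast
  rw [Real.sqrt_eq_rpow, ← Real.rpow_natCast, ← Real.rpow_mul (Nat.cast_nonneg _)]
  norm_num

theorem theorem1 :
    (∀ Γ : Set ℕ, Γ ⊆ Set.Ici 1 →
      Summable (fun γ : Γ => 1 / Real.sqrt ((γ : ℕ) : ℝ)) →
        ∀ w : ℝ → ℝ, IsDeepZeroWeight w → ExpSystemSpans w (Set.Ici 1 \ Γ)) ∧
    (∀ w : ℝ → ℝ, IsDeepZeroWeight w →
      ExpSystemSpans w (Set.Ici 1 \ {m : ℕ | ∃ k : ℕ, 1 ≤ k ∧ m = k ^ 3})) := by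
  refine ⟨fun Γ hΓ hsum w hw => hw.expSystemSpans hΓ hsum, fun w hw => hw.expSystemSpans ?_
    summable_one_div_sqrt_cubes⟩
  rintro _ ⟨k, hk, rfl⟩
  exact Nat.one_le_pow _ _ hk
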